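/- **Setting.** Let $\mathbb R^N$ carry the standard inner product, let its coordinates be partitioned into $n\ge 1$ blocks, and write $x=(x_1,\dots,x_n)$ with $x_i\in\mathbb R^{N_i}$. Consider $$F^*=\min_{x\in\mathbb R^N}\Big\{F(x):=f(x)+g(x)\Big\},\qquad g(x)=\sum_{i=1}^n g_i(x_i),$$ where * $f:\mathbb R^N\to\mathbb R\cup\{\infty\}$ is standard self-concordant: $f$ is closed and convex, its domain $\operatorname{dom}(f)=\{f<\infty\}$ is open, $f$ is three times continuously differentiable on $\operatorname{dom}(f)$, and for all $x\in\operatorname{dom}(f)$ and $u\in\mathbb R^N$ the function $\psi(t)=f(x+tu)$ satisfies $|\psi'''(0)|\le 2\,\psi''(0)^{3/2}$; * each $g_i:\mathbb R^{N_i}\to\mathbb R\cup\{\infty\}$ is proper, closed and convex; * $\nabla^2 f(x)$ is positive definite for every $x\in\operatorname{dom}(F)$, and $F$ has a unique minimizer. Write $\|u\|_x=\sqrt{\langle u,\nabla^2 f(x)u\rangle}$ and $\|v\|_x^*=\sqrt{\langle v,\nabla^2 f(x)^{-1}v\rangle}$. Let $\nabla_i f$ be the $i$-th subvector of the gradient,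 $\nabla^2_{ii}f$ the $i$-th diagonal block of the Hessian, $\|y\|_{x_i}=\sqrt{\langle y,\nabla^2_{ii}f(x)y\rangle}$, $\|z\|_{x_i}^*=\sqrt{\langle z,\nabla^2_{ii}f(x)^{-1}z\rangle}$, and $H(x)=\operatorname{Diag}(\nabla^2_{11}f(x),\dots,\nabla^2_{nn}f(x))$. On vectors, $\|\cdot\|$ is the Euclidean norm; on matrices, it is the spectral norm. **Method (RBPDN).** Let $x^0\in\operatorname{dom}(F)$, $\eta\in[0,1/4]$, and $p_1,\dots,p_n>0$ with $\sum_i p_i=1$. At iteration $k\ge0$ there are directions $d_i(x^k)\in\mathbb R^{N_i}$, $i=1,\dots,n$, such that for each $i$ some $v_i$ satisfies $$-v_i\in\nabla_i f(x^k)+\nabla_{ii}^2f(x^k)\,d_i(x^k)+\partial g_i\big(x_i^k+d_i(x^k)\big),\qquad \|v_i\|^*_{x_i^k}\le\eta\,\|d_i(x^k)\|_{x_i^k}.$$ An index $\iota\in\{1,\dots,n\}$ is drawn with $\mathbb P(\iota=i)=p_i$, independently of $x^k$ and of these directions, and $$x^{k+1}_\iota=x^k_\iota+\frac{d_\iota(x^k)}{1+\|d_\iota(x^k)\|_{x^k_\iota}},\qquad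 x^{k+1}_j=x^k_j\quad(j\ne\iota).$$ **Assumption 2.** Let $$\mathcal S(x^0)=\{x:F(x)\le F(x^0)\},\qquad \bar\lambda(x)=\min_{s\in\partial F(x)}\|s\|_x^*\quad(=+\infty\text{ if }\partial F(x)=\emptyset),$$ $$\tilde d(x)=\arg\min_d\Big\{f(x)+\langle\nabla f(x),d\rangle+\tfrac12\langle d,\nabla^2f(x)d\rangle+g(x+d)\Big\}.$$ There is $c_3>0$ with $\|\tilde d(x)\|\ge c_3\,\bar\lambda(x)$ for all $x\in\mathcal S(x^0)$. **Constants.** Let $p_{\min}=\min_i p_i$ and $\delta_0=F(x^0)-F^*$, let $\omega_*^{-1}$ be the inverse of $\omega_*(t)=-t-\ln(1-t)$ restricted to $[0,1)$, and let $$\sigma_f=\min_{x\in\mathcal S(x^0)}\lambda_{\min}(\nabla^2f(x)),\qquad c_4=\frac{c_1c_3\sqrt{n\sigma_f}}{1-\eta},$$ $$c_1=\frac{1-\eta}{\sqrt n\,\max_{x\in\mathcal S(x^0)}\big\{(1+\eta)\|H(x)^{1/2}\nabla^2f(x)^{-1/2}\|+\|H(x)^{-1/2}\nabla^2f(x)^{1/2}\|\big\}}.$$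 **Theorem.** Under Assumption 2, for every $k\ge0$ the random variable $F(x^k)$ is almost surely finite and integrable, and $$\mathbb E[F(x^k)-F^*]\le\left[1-\frac{c_4^2\,p_{\min}^2\,\big(1-\omega_*^{-1}(\delta_0)\big)}{2\big(1+c_4\,p_{\min}\,\omega_*^{-1}(\delta_0)\big)}\right]^k\big(F(x^0)-F^*\big).$$ -/

import Mathlib

open MeasureTheory ProbabilityTheory
open scoped ENNReal MatrixOrder Matrix.Norms.L2Operator

noncomputable section

namespace RBPDN

/-! ### Extended-valued convex functions -/

section Convex

variable {V : Type*} [NormedAddCommGroup V] [InnerProductSpace ℝ V]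

/-- The effective domain `{x | h x < +∞}` of a function with values in `ℝ ∪ {+∞}`. -/
def dom (h : V → EReal) : Set V := {x | h x ≠ ⊤}

/-- Proper closed convex functions with values in `ℝ ∪ {+∞}`. -/
structure IsProperClosedConvex (h : V → EReal) : Prop where
  ne_bot : ∀ x, h x ≠ ⊥
  nonempty_dom : (dom h).Nonempty
  closed : LowerSemicontinuous h
  convex : ConvexOn ℝ (dom h) (fun x => (h x).toReal)

/-- The convex subdifferential. -/
def subdiff (h : V → EReal) (x : V) : Set V :=
  {s | h x ≠ ⊤ ∧ ∀ y, h x + ((inner ℝ s (y - x) : ℝ) : EReal) ≤ h y}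

/-- Self-concordance with parameter `M`, for a closed convex function with values in
`ℝ ∪ {+∞}` that is three times continuously differentiable on its open domain. -/
structure IsSelfConcordant (f : V → EReal) (M : ℝ) : Prop where
  ne_bot : ∀ x, f x ≠ ⊥
  isOpen_dom : IsOpen (dom f)
  closed : LowerSemicontinuous f
  convex : ConvexOn ℝ (dom f) (fun x => (f x).toReal)
  contDiffOn : ContDiffOn ℝ 3 (fun x => (f x).toReal) (dom f)
  third_deriv_le : ∀ x ∈ dom f, ∀ u : V,
    |iteratedDeriv 3 (fun t : ℝ => (f (x + t • u)).toReal) 0| ≤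
      M * (iteratedDeriv 2 (fun t : ℝ => (f (x + t • u)).toReal) 0) ^ (3 / 2 : ℝ)

end Convex

/-! ### Local norms and matrices -/

section Matrices

variable {m : Type*} [Fintype m] [DecidableEq m]

/-- `A` acting on Euclidean space; its operator norm is the spectral norm of `A`. -/
abbrev act (A : Matrix m m ℝ) : EuclideanSpace ℝ m →L[ℝ] EuclideanSpace ℝ m :=
  Matrix.toEuclideanCLM (𝕜 := ℝ) A

/-- `‖u‖_A = √⟨u, A u⟩`. -/
def wnorm (A : Matrix m m ℝ) (u : EuclideanSpace ℝ m) : ℝ :=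
  Real.sqrt (inner ℝ u (act A u))

/-- `‖v‖_A^* = √⟨v, A⁻¹ v⟩`. -/
def dualNorm (A : Matrix m m ℝ) (v : EuclideanSpace ℝ m) : ℝ :=
  Real.sqrt (inner ℝ v (act A⁻¹ v))

/-- The smallest eigenvalue of a symmetric matrix. -/
def minEigenvalue (A : Matrix m m ℝ) : ℝ := sInf (spectrum ℝ A)

/-- The Hessian matrix of (the real part of) `f` at `x`. -/
def hess (f : EuclideanSpace ℝ m → EReal) (x : EuclideanSpace ℝ m) : Matrix m m ℝ :=
  Matrix.of fun a b =>
    fderiv ℝ (fderiv ℝ fun y => (f y).toReal) x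
      (EuclideanSpace.single a 1) (EuclideanSpace.single b 1)

/-- The gradient of (the real part of) `f` at `x`. -/
def grad (f : EuclideanSpace ℝ m → EReal) (x : EuclideanSpace ℝ m) : EuclideanSpace ℝ m :=
  gradient (fun y => (f y).toReal) x

end Matrices

/-! ### Block structure -/

/-- Euclidean space `ℝ^N`, `N = N₁ + ⋯ + N_n`, with coordinates partitioned into `n` blocks;
the `l`-th coordinate of block `i` has index `⟨i, l⟩`. -/
abbrev Space {n : ℕ} (N : Fin n → ℕ) : Type := EuclideanSpace ℝ (Σ i : Fin n, Fin (N i))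

/-- The space `ℝ^{N_i}` of the `i`-th block. -/
abbrev Block {n : ℕ} (N : Fin n → ℕ) (i : Fin n) : Type := EuclideanSpace ℝ (Fin (N i))

section Blocks

variable {n : ℕ} {N : Fin n → ℕ}

/-- The `i`-th subvector `x_i`. -/
def block (i : Fin n) (x : Space N) : Block N i := WithLp.toLp 2 fun l => x ⟨i, l⟩

/-- The `i`-th diagonal block `A_{ii}`. -/
def diagBlock (A : Matrix (Σ i : Fin n, Fin (N i)) (Σ i : Fin n, Fin (N i)) ℝ) (i : Fin n) :
    Matrix (Fin (N i)) (Fin (N i)) ℝ :=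
  A.submatrix (fun l => ⟨i, l⟩) (fun l => ⟨i, l⟩)

/-- `H(x) = Diag(∇²₁₁ f(x), …, ∇²ₙₙ f(x))`. -/
def blockHess (f : Space N → EReal) (x : Space N) :
    Matrix (Σ i : Fin n, Fin (N i)) (Σ i : Fin n, Fin (N i)) ℝ :=
  Matrix.blockDiagonal' fun i => diagBlock (hess f x) i

/-- `F(x) = f(x) + ∑ i, g_i(x_i)`. -/
def objective (f : Space N → EReal) (g : ∀ i, Block N i → EReal) (x : Space N) : EReal :=
  f x + ∑ i, g i (block i x)

/-- The optimal value `F^*`. -/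
def optVal (f : Space N → EReal) (g : ∀ i, Block N i → EReal) : EReal :=
  ⨅ x, objective f g x

/-- The level set `S(x⁰)`. -/
def levelSet (f : Space N → EReal) (g : ∀ i, Block N i → EReal) (x₀ : Space N) :
    Set (Space N) :=
  {x | objective f g x ≤ objective f g x₀}

/-- Standing assumption: `f` is standard self-concordant, every `g_i` is proper closed convex,
`∇² f` is positive definite on `dom F` (it is continuous there since `f` is `C³` on the open set
`dom f`), and `F` has a unique minimizer. -/
structure StandingAssumption (f : Space N → EReal) (g : ∀ i, Block N i → EReal) : Prop where
  selfConcordant : IsSelfConcordant f 2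
  proper_closed_convex : ∀ i, IsProperClosedConvex (g i)
  posDef : ∀ x ∈ dom (objective f g), (hess f x).PosDef
  unique_min : ∃! x, IsMinOn (objective f g) Set.univ x

/-- `d` is the exact proximal Newton direction at `x`: the minimizer of
`f(x) + ⟨∇f(x), d⟩ + ½ ⟨d, ∇²f(x) d⟩ + g(x + d)`. -/
def IsProxNewtonDir (f : Space N → EReal) (g : ∀ i, Block N i → EReal) (x d : Space N) : Prop :=
  IsMinOn (fun e : Space N =>
    f x + ((inner ℝ (grad f x) e + 1 / 2 * inner ℝ e (act (hess f x) e) : ℝ) : EReal)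
      + ∑ i, g i (block i (x + e))) Set.univ d

/-- `min {‖s‖_x^* : s ∈ ∂F(x)}`, equal to `+∞` if `∂F(x)` is empty. -/
def minSubgradNorm (f : Space N → EReal) (g : ∀ i, Block N i → EReal) (x : Space N) : ℝ≥0∞ :=
  ⨅ s ∈ subdiff (objective f g) x, ENNReal.ofReal (dualNorm (hess f x) s)

/-- `‖d̃(x)‖ ≥ c₃ min {‖s‖_x^* : s ∈ ∂F(x)}` on the level set, for the given `c₃ > 0`. -/
def ErrorBound (f : Space N → EReal) (g : ∀ i, Block N i → EReal) (x₀ : Space N) (c₃ : ℝ) :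
    Prop :=
  0 < c₃ ∧ ∀ x ∈ levelSet f g x₀, ∀ d, IsProxNewtonDir f g x d →
    ENNReal.ofReal c₃ * minSubgradNorm f g x ≤ ENNReal.ofReal ‖d‖

/-! ### The algorithm -/

/-- `‖d_i‖_{x_i} = √⟨d_i, ∇²_{ii} f(x) d_i⟩`. -/
def blockLambda (f : Space N → EReal) (x : Space N) (i : Fin n) (di : Block N i) : ℝ :=
  wnorm (diagBlock (hess f x) i) di

/-- `d_i` is an `η`-inexact solution of the `i`-th block subproblem at `x`:
`-v_i ∈ ∇_i f(x) + ∇²_{ii} f(x) d_i + ∂g_i(x_i + d_i)` and `‖v_i‖_{x_i}^* ≤ η ‖d_i‖_{x_i}`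
for some `v_i`. -/
def IsApproxBlockDir (f : Space N → EReal) (g : ∀ i, Block N i → EReal) (η : ℝ)
    (x : Space N) (i : Fin n) (di : Block N i) : Prop :=
  ∃ v s : Block N i, s ∈ subdiff (g i) (block i x + di) ∧
    -v = block i (grad f x) + act (diagBlock (hess f x) i) di + s ∧
    dualNorm (diagBlock (hess f x) i) v ≤ η * blockLambda f x i di

/-- The damped step in block `i`: `x_i` is replaced by `x_i + d_i / (1 + λ_i)`, with
`λ_i = ‖d_i‖_{x_i}`, and the other blocks are unchanged. Here `d_i` is the `i`-th block of `d`. -/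
def dampedStep (f : Space N → EReal) (x : Space N) (i : Fin n) (d : Space N) : Space N :=
  WithLp.toLp 2 fun a =>
    if a.1 = i then x a + d a / (1 + blockLambda f x i (block i d)) else x a

/-- `X` is a sequence of random iterates of the method. At iteration `k` the index `ι k` is drawn
with law `p`, and `D k` collects directions `(d_1(X k), …, d_n(X k))`, each one an `η`-inexact
solution of its block subproblem; only the block `ι k` of `D k` is used. The drawn index is
independent of the current iterate and of the directions. This is implied by drawing `ι k`
independently of everything that happened before, and it allows the directions to depend on the
whole past (in particular they may be given by fixed functions `d_i(·)` of the iterate). -/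
structure IsRBPDN {Ω : Type*} [MeasurableSpace Ω] (μ : Measure Ω)
    (f : Space N → EReal) (g : ∀ i, Block N i → EReal) (η : ℝ) (p : Fin n → ℝ) (x₀ : Space N)
    (ι : ℕ → Ω → Fin n) (D X : ℕ → Ω → Space N) : Prop where
  measurable_index : ∀ k, Measurable (ι k)
  measurable_dir : ∀ k, Measurable (D k)
  measurable_iterate : ∀ k, Measurable (X k)
  law : ∀ k i, μ {ω | ι k ω = i} = ENNReal.ofReal (p i)
  indep : ∀ k, IndepFun (ι k) (fun ω => (X k ω, D k ω)) μ
  init : ∀ᵐ ω ∂μ, X 0 ω = x₀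
  approx : ∀ k, ∀ᵐ ω ∂μ, ∀ i, IsApproxBlockDir f g η (X k ω) i (block i (D k ω))
  step : ∀ k, ∀ᵐ ω ∂μ, X (k + 1) ω = dampedStep f (X k ω) (ι k ω) (D k ω)

/-! ### The constants -/

/-- `σ_f = min_{x ∈ S(x⁰)} λ_min(∇² f(x))`. -/
def sigmaF (f : Space N → EReal) (g : ∀ i, Block N i → EReal) (x₀ : Space N) : ℝ :=
  sInf ((fun x => minEigenvalue (hess f x)) '' levelSet f g x₀)

/-- `(1+η) ‖H(x)^{1/2} (∇²f(x))^{-1/2}‖ + ‖H(x)^{-1/2} (∇²f(x))^{1/2}‖`. -/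
def blockCond (f : Space N → EReal) (η : ℝ) (x : Space N) : ℝ :=
  (1 + η) * ‖act (CFC.sqrt (blockHess f x) * (CFC.sqrt (hess f x))⁻¹)‖
    + ‖act ((CFC.sqrt (blockHess f x))⁻¹ * CFC.sqrt (hess f x))‖

/-- `c₁ = (1-η) / (√n max_{x ∈ S(x⁰)} blockCond(x))`. -/
def c1 (f : Space N → EReal) (g : ∀ i, Block N i → EReal) (x₀ : Space N) (η : ℝ) : ℝ :=
  (1 - η) / (Real.sqrt n * sSup (blockCond f η '' levelSet f g x₀))

/-- `c₄ = c₁ c₃ √(n σ_f) / (1-η)`. -/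
def c4 (f : Space N → EReal) (g : ∀ i, Block N i → EReal) (x₀ : Space N) (η c₃ : ℝ) : ℝ :=
  c1 f g x₀ η * c₃ * Real.sqrt (n * sigmaF f g x₀) / (1 - η)

/-- `p_min = min_i p_i`. -/
def pMin (p : Fin n → ℝ) : ℝ := ⨅ i, p i

end Blocks

/-- `ω_*(t) = -t - ln(1-t)`. -/
def omegaStar (t : ℝ) : ℝ := -t - Real.log (1 - t)

/-- The inverse of `ω_*` restricted to `[0,1)`. -/
def omegaStarInv (s : ℝ) : ℝ := Function.invFunOn omegaStar (Set.Ico 0 1) s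

end RBPDN

end

open RBPDN

/-!
The proof compares, at every point `x` of the level set, the decrease that one random block step
yields with the optimality gap `δ = F(x) - F^*`.

*Decrease.* Along a line, `(ψ'' + ε)^{-1/2}` is `1`-Lipschitz for a standard self-concordant `ψ`;
letting `ε → 0` and integrating twice bounds `f` below and above by its linearization plus `ω` and
`ω_*` of the local norm of the step (`selfConcordant_bounds`). The upper bound needs no knowledge
that the end point lies in `dom f`: finiteness follows because `f` is closed with open domain
(`IsSelfConcordant.dikin`). With the subgradient inequality for `g_i`, the damped step in block `i`
decreases `F` by at least `ω(λ_i) / 2`, where `λ_i = ‖d_i‖_{x_i}`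
(`StandingAssumption.dampedStep_descent`). In particular the iterates stay in the level set.

*Gap.* If `s ∈ ∂F(x)` has local dual norm less than `1`, then `δ ≤ ω_*(‖s‖_x^*)`, by the lower bound
on `f` and the conjugacy of `ω` and `ω_*`
(`StandingAssumption.objective_sub_le_omegaStar`). Hence `t = ω_*⁻¹(δ)` is a lower bound for the
local dual norms of all subgradients.

*Link.* The subgradients that define the inexact block directions `d` give an affine minorant of
`g`, so the exact proximal Newton direction `d̃` exists. Monotonicity of `∂g` bounds `‖d̃‖_x` by
`blockCond` times the local norm of `d` for the block diagonal Hessian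
(`StandingAssumption.wnorm_proxNewton_le`). With the error bound this gives `c₄ t ≤ ∑ λ_i`
(`StandingAssumption.c4_mul_le_sum`).

By Jensen's inequality for `ω`, the averaged decrease `½ ∑ p_i ω(λ_i)` is then at least
`½ ω(c₄ p_min t)`, and `ω(t) ≥ t² / (2 (1 + t))`, `ω_*(t) ≤ t² / (2 (1 - t))` turn this into
`(1 - q) δ` (`StandingAssumption.gap_mul_le_sum_omega`). Independence of the drawn index gives the
contraction of the expected gap (`IsRBPDN.integral_gap_succ_le`).
-/

namespace RBPDN

/-! ### The functions `ω` and `ω_*` -/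

/-- `ω(t) = t - ln(1+t)`, the convex conjugate of `ω_*`. -/
noncomputable def omega (t : ℝ) : ℝ := t - Real.log (1 + t)

lemma log_le_half_sub_inv {y : ℝ} (hy : 1 ≤ y) : Real.log y ≤ (y - y⁻¹) / 2 := by
  rw [← Real.sinh_log (by linarith)]
  exact Real.self_le_sinh_iff.2 (Real.log_nonneg hy)

lemma sq_div_le_omega {t : ℝ} (ht : 0 ≤ t) : t ^ 2 / (2 * (1 + t)) ≤ omega t := by
  have h := log_le_half_sub_inv (y := 1 + t) (by linarith)
  have e : t - (1 + t - (1 + t)⁻¹) / 2 = t ^ 2 / (2 * (1 + t)) := by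
    field_simp; ring
  rw [← e]; unfold omega; linarith

lemma omegaStar_le_sq_div {t : ℝ} (ht : 0 ≤ t) (ht1 : t < 1) :
    omegaStar t ≤ t ^ 2 / (2 * (1 - t)) := by
  have h1 : 0 < 1 - t := by linarith
  have h := log_le_half_sub_inv (y := (1 - t)⁻¹) ((one_le_inv₀ h1).2 (by linarith))
  rw [Real.log_inv, inv_inv] at h
  have e : -t + ((1 - t)⁻¹ - (1 - t)) / 2 = t ^ 2 / (2 * (1 - t)) := by
    field_simp; ring
  rw [← e]; unfold omegaStar; linarith

/-- The Fenchel–Young inequality for the conjugate pair `ω`, `ω_*`. -/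
lemma mul_le_omega_add_omegaStar {r t : ℝ} (hr : 0 ≤ r) (ht1 : t < 1) :
    t * r ≤ omega r + omegaStar t := by
  have h1 : 0 < 1 - t := by linarith
  have h2 : 0 < 1 + r := by linarith
  have h := Real.log_le_sub_one_of_pos (mul_pos h2 h1)
  rw [Real.log_mul h2.ne' h1.ne'] at h
  unfold omega omegaStar
  linarith

lemma omega_mono {a b : ℝ} (ha : 0 ≤ a) (hab : a ≤ b) : omega a ≤ omega b := by
  have h1 : 0 < 1 + a := by linarith
  have h2 : 0 < 1 + b := by linarith
  have h := Real.log_le_sub_one_of_pos (div_pos h2 h1)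
  rw [Real.log_div h2.ne' h1.ne'] at h
  have : (1 + b) / (1 + a) - 1 ≤ b - a := by
    rw [div_sub_one h1.ne', div_le_iff₀ h1]; nlinarith
  unfold omega; linarith

lemma omega_nonneg {t : ℝ} (ht : 0 ≤ t) : 0 ≤ omega t := by
  have := omega_mono le_rfl ht
  simpa [omega] using this

lemma omegaStar_zero : omegaStar 0 = 0 := by simp [omegaStar]

lemma omegaStar_strictMonoOn : StrictMonoOn omegaStar (Set.Ico 0 1) := by
  rintro a ⟨ha, ha1⟩ b ⟨hb, hb1⟩ hab
  have h1 : 0 < 1 - a := by linarith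
  have h2 : 0 < 1 - b := by linarith
  have hne : (1 - b) / (1 - a) ≠ 1 := by
    rw [Ne, div_eq_one_iff_eq h1.ne']; intro h; linarith
  have h := Real.log_lt_sub_one_of_pos (div_pos h2 h1) hne
  rw [Real.log_div h2.ne' h1.ne'] at h
  have : (1 - b) / (1 - a) - 1 ≤ a - b := by
    rw [div_sub_one h1.ne', div_le_iff₀ h1]; nlinarith
  unfold omegaStar; linarith

lemma omegaStar_surjOn {s : ℝ} (hs : 0 ≤ s) : ∃ t ∈ Set.Ico (0 : ℝ) 1, omegaStar t = s := by
  -- `ω_*(1 - e^{-(s+1)}) = s + e^{-(s+1)} ≥ s`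
  set b : ℝ := 1 - Real.exp (-(s + 1)) with hb
  have he := Real.exp_pos (-(s + 1))
  have he1 : Real.exp (-(s + 1)) ≤ 1 := Real.exp_le_one_iff.2 (by linarith)
  have hb1 : b < 1 := by linarith
  have hsb : s ≤ omegaStar b := by
    have : 1 - b = Real.exp (-(s + 1)) := by rw [hb]; ring
    unfold omegaStar
    rw [this, Real.log_exp]; linarith
  have hc : ContinuousOn omegaStar (Set.Icc 0 b) := by
    unfold omegaStar
    refine continuousOn_id.neg.sub (ContinuousOn.log (by fun_prop) ?_)
    rintro x ⟨-, hx⟩; linarith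
  obtain ⟨t, ht, hts⟩ := intermediate_value_Icc (by linarith) hc
    (show s ∈ Set.Icc (omegaStar 0) (omegaStar b) from ⟨by rw [omegaStar_zero]; exact hs, hsb⟩)
  exact ⟨t, ⟨ht.1, ht.2.trans_lt hb1⟩, hts⟩

lemma omegaStarInv_mem {s : ℝ} (hs : 0 ≤ s) : omegaStarInv s ∈ Set.Ico (0 : ℝ) 1 :=
  Function.invFunOn_mem (omegaStar_surjOn hs)

lemma omegaStar_omegaStarInv {s : ℝ} (hs : 0 ≤ s) : omegaStar (omegaStarInv s) = s :=
  Function.invFunOn_eq (omegaStar_surjOn hs)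

lemma omegaStarInv_le {s t : ℝ} (hs : 0 ≤ s) (ht : 0 ≤ t) (h : t < 1 → s ≤ omegaStar t) :
    omegaStarInv s ≤ t := by
  by_contra! hlt
  have h1 := (omegaStarInv_mem hs).2
  have := omegaStar_strictMonoOn ⟨ht, hlt.trans h1⟩ (omegaStarInv_mem hs) hlt
  rw [omegaStar_omegaStarInv hs] at this
  linarith [h (hlt.trans h1)]

/-- Jensen's inequality for `ω`. -/
lemma omega_sum_le {ι : Type*} [Fintype ι] {p l : ι → ℝ} (hp : ∀ i, 0 ≤ p i)
    (hp1 : ∑ i, p i = 1) (hl : ∀ i, 0 ≤ l i) :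
    omega (∑ i, p i * l i) ≤ ∑ i, p i * omega (l i) := by
  have h := strictConcaveOn_log_Ioi.concaveOn.le_map_sum (t := Finset.univ) (w := p)
    (p := fun i => 1 + l i) (fun i _ => hp i) hp1
    (fun i _ => Set.mem_Ioi.2 (by linarith [hl i]))
  simp only [smul_eq_mul, mul_add, mul_one, Finset.sum_add_distrib, hp1] at h
  simp only [omega, mul_sub, Finset.sum_sub_distrib]
  linarith

/-- The decrease of a damped step: with step size `1 / (1 + l)` the bound on the change of `F`
equals `-ω(l) + η l² / (1 + l)`, and `l² / (1 + l) ≤ 2 ω(l)`. -/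
lemma omegaStar_damped_le {η l : ℝ} (hη : η ≤ 1 / 4) (hl : 0 ≤ l) :
    (1 + l)⁻¹ * (-(1 - η) * l ^ 2) + omegaStar ((1 + l)⁻¹ * l) ≤ -(1 / 2) * omega l := by
  have h1 : 0 < 1 + l := by linarith
  have hq := sq_div_le_omega hl
  have e1 : 1 - (1 + l)⁻¹ * l = (1 + l)⁻¹ := by field_simp; ring
  have e2 : l ^ 2 / (2 * (1 + l)) = (1 + l)⁻¹ * l ^ 2 / 2 := by field_simp
  have e3 : (1 + l)⁻¹ * l ^ 2 = l - (1 + l)⁻¹ * l := by field_simp; ring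
  have hq0 : 0 ≤ (1 + l)⁻¹ * l ^ 2 := by positivity
  have h4 : η * ((1 + l)⁻¹ * l ^ 2) ≤ 1 / 4 * ((1 + l)⁻¹ * l ^ 2) :=
    mul_le_mul_of_nonneg_right hη hq0
  rw [omegaStar, e1, Real.log_inv]
  rw [e2] at hq
  unfold omega at *
  nlinarith

/-! ### Self-concordant functions of one variable -/

lemma le_of_hasDerivAt_nonneg {a a' : ℝ → ℝ} {T : ℝ} (hT : 0 ≤ T)
    (h : ∀ t ∈ Set.Icc 0 T, HasDerivAt a (a' t) t) (h' : ∀ t ∈ Set.Icc 0 T, 0 ≤ a' t) :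
    a 0 ≤ a T := by
  have hm : MonotoneOn a (Set.Icc 0 T) := by
    refine monotoneOn_of_deriv_nonneg (convex_Icc 0 T)
      (fun t ht => (h t ht).continuousAt.continuousWithinAt)
      (fun t ht => (h t (interior_subset ht)).differentiableAt.differentiableWithinAt) ?_
    intro t ht
    rw [(h t (interior_subset ht)).deriv]
    exact h' t (interior_subset ht)
  exact hm ⟨le_rfl, hT⟩ ⟨hT, le_rfl⟩ hT

lemma le_of_hasDerivAt_two_nonneg {a a₁ a₂ : ℝ → ℝ} {T : ℝ} (hT : 0 ≤ T)
    (h₁ : ∀ t ∈ Set.Icc 0 T, HasDerivAt a (a₁ t) t)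
    (h₂ : ∀ t ∈ Set.Icc 0 T, HasDerivAt a₁ (a₂ t) t)
    (h0 : a₁ 0 = 0) (hn : ∀ t ∈ Set.Icc 0 T, 0 ≤ a₂ t) :
    a 0 ≤ a T := by
  refine le_of_hasDerivAt_nonneg hT h₁ fun t ht => ?_
  rw [← h0]
  exact le_of_hasDerivAt_nonneg ht.1 (fun s hs => h₂ s ⟨hs.1, hs.2.trans ht.2⟩)
    (fun s hs => hn s ⟨hs.1, hs.2.trans ht.2⟩)

/-- If `|φ'| ≤ 2 φ^{3/2}`, then `(φ + ε)^{-1/2}` is `1`-Lipschitz; with `ε → 0` this bounds `φ`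
even where `φ` vanishes. -/
lemma sqrt_bounds_of_abs_deriv_le {φ φ' : ℝ → ℝ} {T : ℝ} (hT : 0 ≤ T)
    (h : ∀ t ∈ Set.Icc 0 T, HasDerivAt φ (φ' t) t) (h0 : ∀ t ∈ Set.Icc 0 T, 0 ≤ φ t)
    (h' : ∀ t ∈ Set.Icc 0 T, |φ' t| ≤ 2 * φ t ^ (3 / 2 : ℝ)) :
    √(φ T) * (1 - √(φ 0) * T) ≤ √(φ 0) ∧ √(φ 0) ≤ √(φ T) * (1 + √(φ 0) * T) := by
  have key : ∀ ε > 0, √(φ T + ε) * (1 - √(φ 0 + ε) * T) ≤ √(φ 0 + ε) ∧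
      √(φ 0 + ε) ≤ √(φ T + ε) * (1 + √(φ 0 + ε) * T) := by
    intro ε hε
    have hpos : ∀ t ∈ Set.Icc 0 T, 0 < √(φ t + ε) := fun t ht =>
      Real.sqrt_pos.2 (by linarith [h0 t ht])
    have hd : ∀ t ∈ Set.Icc 0 T, HasDerivAt (fun t => (√(φ t + ε))⁻¹)
        (-(φ' t / (2 * √(φ t + ε))) / √(φ t + ε) ^ 2) t := fun t ht =>
      (((h t ht).add_const ε).sqrt (by linarith [h0 t ht])).inv (hpos t ht).ne'
    have hb : ∀ t ∈ Set.Icc 0 T, ‖-(φ' t / (2 * √(φ t + ε))) / √(φ t + ε) ^ 2‖ ≤ 1 := by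
      intro t ht
      have hp := hpos t ht
      rw [norm_div, norm_neg, norm_div, Real.norm_eq_abs, Real.norm_eq_abs, Real.norm_eq_abs,
        abs_of_pos (by positivity : 0 < 2 * √(φ t + ε)),
        abs_of_pos (by positivity : 0 < √(φ t + ε) ^ 2), div_div, div_le_one (by positivity)]
      refine (h' t ht).trans ?_
      have e : φ t ^ (3 / 2 : ℝ) = √(φ t) ^ 3 := by
        rw [Real.sqrt_eq_rpow, ← Real.rpow_natCast, ← Real.rpow_mul (h0 t ht)]; norm_num
      have hs : √(φ t) ≤ √(φ t + ε) := Real.sqrt_le_sqrt (by linarith)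
      have := pow_le_pow_left₀ (Real.sqrt_nonneg _) hs 3
      rw [e]
      nlinarith
    have hL := (convex_Icc 0 T).norm_image_sub_le_of_norm_hasDerivWithin_le
      (fun t ht => (hd t ht).hasDerivWithinAt) hb
      (Set.left_mem_Icc.2 hT) (Set.right_mem_Icc.2 hT)
    rw [one_mul, sub_zero, Real.norm_eq_abs, Real.norm_eq_abs, abs_of_nonneg hT, abs_le] at hL
    have p0 := hpos 0 (Set.left_mem_Icc.2 hT)
    have pT := hpos T (Set.right_mem_Icc.2 hT)
    set a := √(φ 0 + ε)
    set b := √(φ T + ε)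
    have ha : a * a⁻¹ = 1 := mul_inv_cancel₀ p0.ne'
    have hb : b * b⁻¹ = 1 := mul_inv_cancel₀ pT.ne'
    have hab : 0 < a * b := mul_pos p0 pT
    constructor
    · have := mul_le_mul_of_nonneg_left hL.1 hab.le
      have e : a * b * (b⁻¹ - a⁻¹) = a * (b * b⁻¹) - b * (a * a⁻¹) := by ring
      rw [e, ha, hb] at this
      linarith
    · have := mul_le_mul_of_nonneg_left hL.2 hab.le
      have e : a * b * (b⁻¹ - a⁻¹) = a * (b * b⁻¹) - b * (a * a⁻¹) := by ring
      rw [e, ha, hb] at this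
      linarith
  have lim : ∀ c : ℝ, Filter.Tendsto (fun ε : ℝ => √(c + ε)) (nhdsWithin 0 (Set.Ioi 0))
      (nhds √c) := by
    intro c
    have : Continuous fun ε : ℝ => √(c + ε) := by fun_prop
    simpa using (this.tendsto 0).mono_left nhdsWithin_le_nhds
  have ev : ∀ᶠ ε in nhdsWithin (0 : ℝ) (Set.Ioi 0), ε > 0 := self_mem_nhdsWithin
  constructor
  · exact le_of_tendsto_of_tendsto
      ((lim _).mul (tendsto_const_nhds.sub ((lim _).mul_const T))) (lim _)
      (ev.mono fun ε hε => (key ε hε).1)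
  · exact le_of_tendsto_of_tendsto (lim _)
      ((lim _).mul (tendsto_const_nhds.add ((lim _).mul_const T)))
      (ev.mono fun ε hε => (key ε hε).2)

/-- The two-sided bound on a standard self-concordant function of one variable. The derivatives
`ψ₁, ψ₂, ψ₃` of `ψ` are given explicitly. -/
lemma selfConcordant_bounds {ψ ψ₁ ψ₂ ψ₃ : ℝ → ℝ} {T : ℝ} (hT : 0 ≤ T)
    (h₁ : ∀ t ∈ Set.Icc 0 T, HasDerivAt ψ (ψ₁ t) t)
    (h₂ : ∀ t ∈ Set.Icc 0 T, HasDerivAt ψ₁ (ψ₂ t) t)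
    (h₃ : ∀ t ∈ Set.Icc 0 T, HasDerivAt ψ₂ (ψ₃ t) t)
    (h0 : ∀ t ∈ Set.Icc 0 T, 0 ≤ ψ₂ t)
    (h : ∀ t ∈ Set.Icc 0 T, |ψ₃ t| ≤ 2 * ψ₂ t ^ (3 / 2 : ℝ)) :
    ψ 0 + ψ₁ 0 * T + omega (√(ψ₂ 0) * T) ≤ ψ T ∧
      (√(ψ₂ 0) * T < 1 → ψ T ≤ ψ 0 + ψ₁ 0 * T + omegaStar (√(ψ₂ 0) * T)) := by
  set l := √(ψ₂ 0) with hl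
  have hl0 : 0 ≤ l := Real.sqrt_nonneg _
  have bd : ∀ t ∈ Set.Icc 0 T,
      √(ψ₂ t) * (1 - l * t) ≤ l ∧ l ≤ √(ψ₂ t) * (1 + l * t) := fun t ht =>
    sqrt_bounds_of_abs_deriv_le ht.1 (fun s hs => h₃ s ⟨hs.1, hs.2.trans ht.2⟩)
      (fun s hs => h0 s ⟨hs.1, hs.2.trans ht.2⟩) (fun s hs => h s ⟨hs.1, hs.2.trans ht.2⟩)
  constructor
  · have pos : ∀ t ∈ Set.Icc 0 T, 0 < 1 + l * t := fun t ht => by nlinarith [ht.1]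
    have := le_of_hasDerivAt_two_nonneg (a := fun t => ψ t - ψ₁ 0 * t - omega (l * t))
      (a₁ := fun t => ψ₁ t - ψ₁ 0 - (l - l / (1 + l * t)))
      (a₂ := fun t => ψ₂ t - l ^ 2 / (1 + l * t) ^ 2) hT ?_ ?_ ?_ ?_
    · simp only [mul_zero, sub_zero] at this
      have e : omega 0 = 0 := by simp [omega]
      rw [e] at this
      linarith
    · intro t ht
      have hlin : HasDerivAt (fun t => l * t) l t := by simpa using (hasDerivAt_id t).const_mul l
      have hlog := (hlin.const_add 1).log (pos t ht).ne'
      have hc : HasDerivAt (fun t => ψ₁ 0 * t) (ψ₁ 0) t := by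
        simpa using (hasDerivAt_id t).const_mul (ψ₁ 0)
      exact ((h₁ t ht).sub hc).sub (hlin.sub hlog)
    · intro t ht
      have hlin : HasDerivAt (fun t => l * t) l t := by simpa using (hasDerivAt_id t).const_mul l
      have hq := ((hasDerivAt_const t l).div (hlin.const_add 1) (pos t ht).ne').const_sub l
      refine (((h₂ t ht).sub_const (ψ₁ 0)).sub hq).congr_deriv ?_
      ring
    · simp
    · intro t ht
      have hb := (bd t ht).2
      rw [sub_nonneg, div_le_iff₀ (by have := pos t ht; positivity), ← Real.sq_sqrt (h0 t ht),
        ← mul_pow]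
      exact pow_le_pow_left₀ hl0 hb 2
  · intro hlT
    have pos : ∀ t ∈ Set.Icc 0 T, 0 < 1 - l * t := fun t ht => by
      nlinarith [ht.2, mul_le_mul_of_nonneg_left ht.2 hl0]
    have := le_of_hasDerivAt_two_nonneg (a := fun t => omegaStar (l * t) - (ψ t - ψ₁ 0 * t))
      (a₁ := fun t => (-l - -l / (1 - l * t)) - (ψ₁ t - ψ₁ 0))
      (a₂ := fun t => l ^ 2 / (1 - l * t) ^ 2 - ψ₂ t) hT ?_ ?_ ?_ ?_
    · simp only [mul_zero, sub_zero] at this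
      rw [omegaStar_zero] at this
      linarith
    · intro t ht
      have hlin : HasDerivAt (fun t => l * t) l t := by simpa using (hasDerivAt_id t).const_mul l
      have hlog := (hlin.const_sub 1).log (pos t ht).ne'
      have hc : HasDerivAt (fun t => ψ₁ 0 * t) (ψ₁ 0) t := by
        simpa using (hasDerivAt_id t).const_mul (ψ₁ 0)
      exact (hlin.neg.sub hlog).sub ((h₁ t ht).sub hc)
    · intro t ht
      have hlin : HasDerivAt (fun t => l * t) l t := by simpa using (hasDerivAt_id t).const_mul l
      have hq := ((hasDerivAt_const t (-l)).div (hlin.const_sub 1) (pos t ht).ne').const_sub (-l)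
      refine (hq.sub ((h₂ t ht).sub_const (ψ₁ 0))).congr_deriv ?_
      ring
    · simp
    · intro t ht
      have hb := (bd t ht).1
      rw [sub_nonneg, le_div_iff₀ (by have := pos t ht; positivity), ← Real.sq_sqrt (h0 t ht),
        ← mul_pow]
      exact pow_le_pow_left₀ (mul_nonneg (Real.sqrt_nonneg _) (pos t ht).le) hb 2

/-! ### Self-concordant functions along segments -/

section Segments

variable {V : Type*} [NormedAddCommGroup V] [InnerProductSpace ℝ V] {f : V → EReal}

lemma line_hasDerivAt {h : V → ℝ} {x u : V} {t : ℝ} (hd : DifferentiableAt ℝ h (x + t • u)) :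
    HasDerivAt (fun s : ℝ => h (x + s • u)) (fderiv ℝ h (x + t • u) u) t := by
  have hl : HasDerivAt (fun s : ℝ => x + s • u) u t := by
    simpa using ((hasDerivAt_id t).smul_const u).const_add x
  exact hd.hasFDerivAt.comp_hasDerivAt t hl

lemma line_hasDerivAt_fderiv {h : V → ℝ} {x u : V} {t : ℝ}
    (hd : DifferentiableAt ℝ (fderiv ℝ h) (x + t • u)) :
    HasDerivAt (fun s : ℝ => fderiv ℝ h (x + s • u) u)
      (fderiv ℝ (fderiv ℝ h) (x + t • u) u u) t := by
  have hl : HasDerivAt (fun s : ℝ => x + s • u) u t := by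
    simpa using ((hasDerivAt_id t).smul_const u).const_add x
  have := hd.hasFDerivAt.comp_hasDerivAt t hl
  simpa using this.clm_apply (hasDerivAt_const t u)

lemma IsSelfConcordant.contDiffAt {M : ℝ} (hf : IsSelfConcordant f M) {x : V} (hx : x ∈ dom f) :
    ContDiffAt ℝ 3 (fun y => (f y).toReal) x :=
  hf.contDiffOn.contDiffAt (hf.isOpen_dom.mem_nhds hx)

lemma IsSelfConcordant.differentiableAt {M : ℝ} (hf : IsSelfConcordant f M) {x : V}
    (hx : x ∈ dom f) : DifferentiableAt ℝ (fun y => (f y).toReal) x :=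
  (hf.contDiffAt hx).differentiableAt (by norm_num)

lemma IsSelfConcordant.differentiableAt_fderiv {M : ℝ} (hf : IsSelfConcordant f M) {x : V}
    (hx : x ∈ dom f) : DifferentiableAt ℝ (fderiv ℝ fun y => (f y).toReal) x :=
  ((hf.contDiffAt hx).fderiv_right (m := 2) (by norm_num)).differentiableAt (by norm_num)

lemma IsSelfConcordant.differentiableAt_fderiv_fderiv {M : ℝ} (hf : IsSelfConcordant f M) {x : V}
    (hx : x ∈ dom f) : DifferentiableAt ℝ (fderiv ℝ (fderiv ℝ fun y => (f y).toReal)) x :=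
  (((hf.contDiffAt hx).fderiv_right (m := 2) (by norm_num)).fderiv_right (m := 1)
    (by norm_num)).differentiableAt (by norm_num)

lemma IsSelfConcordant.isOpen_line {M : ℝ} (hf : IsSelfConcordant f M) (x u : V) :
    IsOpen {t : ℝ | x + t • u ∈ dom f} :=
  hf.isOpen_dom.preimage (f := fun t : ℝ => x + t • u) (by fun_prop)

lemma IsSelfConcordant.convexOn_line {M : ℝ} (hf : IsSelfConcordant f M) (x u : V) :
    ConvexOn ℝ {t : ℝ | x + t • u ∈ dom f} (fun t => (f (x + t • u)).toReal) := by
  have e : ∀ {a b s t : ℝ}, a + b = 1 →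
      x + (a • s + b • t) • u = a • (x + s • u) + b • (x + t • u) := by
    intro a b s t hab
    have : x = (a + b) • x := by rw [hab, one_smul]
    simp only [smul_eq_mul]
    conv_lhs => rw [this]
    module
  refine ⟨fun s hs t ht a b ha hb hab => ?_, fun s hs t ht a b ha hb hab => ?_⟩
  · change _ ∈ dom f
    rw [e hab]
    exact hf.convex.1 hs ht ha hb hab
  · change (f _).toReal ≤ _
    rw [e hab]
    exact hf.convex.2 hs ht ha hb hab

lemma IsSelfConcordant.eventually_deriv_line {M : ℝ} (hf : IsSelfConcordant f M) {x : V}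
    (hx : x ∈ dom f) (u : V) :
    iteratedDeriv 2 (fun t : ℝ => (f (x + t • u)).toReal) =ᶠ[nhds 0]
      fun t => fderiv ℝ (fderiv ℝ fun y => (f y).toReal) (x + t • u) u u := by
  have h0 : (0 : ℝ) ∈ {t : ℝ | x + t • u ∈ dom f} := by simpa using hx
  have hev : ∀ᶠ t in nhds (0 : ℝ), x + t • u ∈ dom f := (hf.isOpen_line x u).mem_nhds h0
  filter_upwards [hev.eventually_nhds] with t ht
  rw [iteratedDeriv_succ, iteratedDeriv_one]
  have h1 : deriv (fun t : ℝ => (f (x + t • u)).toReal) =ᶠ[nhds t]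
      fun s => fderiv ℝ (fun y => (f y).toReal) (x + s • u) u :=
    ht.mono fun s hs => (line_hasDerivAt (hf.differentiableAt hs)).deriv
  rw [h1.deriv_eq]
  exact (line_hasDerivAt_fderiv (hf.differentiableAt_fderiv ht.self_of_nhds)).deriv

lemma IsSelfConcordant.hessian_nonneg {M : ℝ} (hf : IsSelfConcordant f M) {x : V}
    (hx : x ∈ dom f) (u : V) : 0 ≤ fderiv ℝ (fderiv ℝ fun y => (f y).toReal) x u u := by
  set J := {t : ℝ | x + t • u ∈ dom f}
  have h0 : (0 : ℝ) ∈ J := by simpa [J] using hx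
  have hd : ∀ t ∈ J, HasDerivAt (fun t : ℝ => (f (x + t • u)).toReal)
      (fderiv ℝ (fun y => (f y).toReal) (x + t • u) u) t := fun t ht =>
    line_hasDerivAt (hf.differentiableAt ht)
  have hm := (hf.convexOn_line x u).monotoneOn_deriv fun t ht => (hd t ht).differentiableAt
  have h2 := MonotoneOn.derivWithin_nonneg hm (x := 0)
  have hJ : J ∈ nhds (0 : ℝ) := (hf.isOpen_line x u).mem_nhds h0
  rw [derivWithin_of_mem_nhds hJ] at h2
  have h3 := (hf.eventually_deriv_line hx u).self_of_nhds
  rw [iteratedDeriv_succ, iteratedDeriv_one] at h3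
  rw [h3] at h2
  simpa using h2

/-- The self-concordance inequality as a bound on the derivative of
`t ↦ D² f(x + t u)[u, u]`. -/
lemma IsSelfConcordant.abs_deriv_hessian_le (hf : IsSelfConcordant f 2) {x u : V} {t : ℝ}
    (ht : x + t • u ∈ dom f) :
    |deriv (fun s : ℝ => fderiv ℝ (fderiv ℝ fun y => (f y).toReal) (x + s • u) u u) t| ≤
      2 * (fderiv ℝ (fderiv ℝ fun y => (f y).toReal) (x + t • u) u u) ^ (3 / 2 : ℝ) := by
  have h := hf.third_deriv_le _ ht u
  have hev := hf.eventually_deriv_line ht u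
  rw [iteratedDeriv_succ, hev.deriv_eq, hev.self_of_nhds] at h
  have e : (fun s : ℝ => fderiv ℝ (fderiv ℝ fun y => (f y).toReal) (x + t • u + s • u) u u) =
      fun s => (fun s : ℝ => fderiv ℝ (fderiv ℝ fun y => (f y).toReal) (x + s • u) u u)
        (t + s) := by
    funext s
    simp only [add_smul, add_assoc]
  rw [e] at h
  have hs := deriv_comp_const_add
    (f := fun s : ℝ => fderiv ℝ (fderiv ℝ fun y => (f y).toReal) (x + s • u) u u) t 0
  rw [hs] at h
  simpa using h

/-- The two-sided self-concordance bound between two points of the domain. -/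
lemma IsSelfConcordant.bounds (hf : IsSelfConcordant f 2) {x u : V} (hx : x ∈ dom f)
    {T : ℝ} (hT : 0 ≤ T) (hxu : x + T • u ∈ dom f) {l : ℝ}
    (hl : l = √(fderiv ℝ (fderiv ℝ fun y => (f y).toReal) x u u)) :
    (f x).toReal + fderiv ℝ (fun y => (f y).toReal) x u * T + omega (l * T)
        ≤ (f (x + T • u)).toReal ∧
      (l * T < 1 → (f (x + T • u)).toReal ≤
        (f x).toReal + fderiv ℝ (fun y => (f y).toReal) x u * T + omegaStar (l * T)) := by
  have hJ : ∀ t ∈ Set.Icc 0 T, x + t • u ∈ dom f := fun t ht =>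
    (hf.convexOn_line x u).1.ordConnected.out
      (show (0 : ℝ) ∈ {t : ℝ | x + t • u ∈ dom f} by simpa using hx) hxu ht
  have := selfConcordant_bounds hT
    (ψ := fun t => (f (x + t • u)).toReal)
    (ψ₁ := fun t => fderiv ℝ (fun y => (f y).toReal) (x + t • u) u)
    (ψ₂ := fun t => fderiv ℝ (fderiv ℝ fun y => (f y).toReal) (x + t • u) u u)
    (ψ₃ := deriv fun t => fderiv ℝ (fderiv ℝ fun y => (f y).toReal) (x + t • u) u u)
    (fun t ht => line_hasDerivAt (hf.differentiableAt (hJ t ht)))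
    (fun t ht => line_hasDerivAt_fderiv (hf.differentiableAt_fderiv (hJ t ht)))
    (fun t ht => ?_) (fun t ht => hf.hessian_nonneg (hJ t ht) u)
    (fun t ht => hf.abs_deriv_hessian_le (hJ t ht))
  · simpa [hl] using this
  · refine DifferentiableAt.hasDerivAt ?_
    have hd := hf.differentiableAt_fderiv_fderiv (hJ t ht)
    have hl : DifferentiableAt ℝ (fun s : ℝ => x + s • u) t := by fun_prop
    exact ((hd.comp t hl).clm_apply (differentiableAt_const u)).clm_apply
      (differentiableAt_const u)

/-- The open Dikin ellipsoid lies in the domain: along the segment `f` stays below a finite bound,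
so the part of the segment inside the open set `dom f` is closed. -/
lemma IsSelfConcordant.dikin (hf : IsSelfConcordant f 2) {x u : V} (hx : x ∈ dom f)
    {T : ℝ} (hT : 0 ≤ T)
    (hl : √(fderiv ℝ (fderiv ℝ fun y => (f y).toReal) x u u) * T < 1) : x + T • u ∈ dom f := by
  set l := √(fderiv ℝ (fderiv ℝ fun y => (f y).toReal) x u u) with hldef
  have hl0 : 0 ≤ l := Real.sqrt_nonneg _
  set C : ℝ := (f x).toReal + |fderiv ℝ (fun y => (f y).toReal) x u| * T + omegaStar (l * T)
    with hC
  have hbound : ∀ t ∈ Set.Icc 0 T, x + t • u ∈ dom f → f (x + t • u) ≤ (C : EReal) := by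
    intro t ht hxt
    have hlt : l * t ≤ l * T := mul_le_mul_of_nonneg_left ht.2 hl0
    have h1 := (hf.bounds hx ht.1 hxt hldef).2 (hlt.trans_lt hl)
    have h2 : omegaStar (l * t) ≤ omegaStar (l * T) :=
      omegaStar_strictMonoOn.monotoneOn ⟨mul_nonneg hl0 ht.1, hlt.trans_lt hl⟩
        ⟨mul_nonneg hl0 hT, hl⟩ hlt
    have h3 : fderiv ℝ (fun y => (f y).toReal) x u * t ≤
        |fderiv ℝ (fun y => (f y).toReal) x u| * T :=
      mul_le_mul (le_abs_self _) ht.2 ht.1 (abs_nonneg _)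
    rw [← EReal.coe_toReal hxt (hf.ne_bot _)]
    exact EReal.coe_le_coe_iff.2 (by linarith)
  set S := {t : ℝ | f (x + t • u) ≤ (C : EReal)} with hS
  have hSc : IsClosed S := by
    have : LowerSemicontinuous fun t : ℝ => f (x + t • u) :=
      LowerSemicontinuous.comp hf.closed (by fun_prop)
    exact this.isClosed_preimage _
  have hcl : IsClosed (S ∩ Set.Icc 0 T) := hSc.inter isClosed_Icc
  have hS0 : (0 : ℝ) ∈ S := hbound 0 ⟨le_rfl, hT⟩ (by simpa using hx)
  have hsub := hcl.Icc_subset_of_forall_mem_nhdsWithin hS0 fun t ht => ?_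
  · have : T ∈ S := hsub ⟨hT, le_rfl⟩
    exact (lt_of_le_of_lt this (EReal.coe_lt_top C)).ne
  · have htd : x + t • u ∈ dom f := (lt_of_le_of_lt ht.1 (EReal.coe_lt_top C)).ne
    have hn : {t : ℝ | x + t • u ∈ dom f} ∈ nhds t := (hf.isOpen_line x u).mem_nhds htd
    have hT' : Set.Iio T ∈ nhds t := Iio_mem_nhds ht.2.2
    filter_upwards [mem_nhdsWithin_of_mem_nhds hn, mem_nhdsWithin_of_mem_nhds hT',
      self_mem_nhdsWithin] with s hs hsT hst
    exact hbound s ⟨ht.2.1.trans (le_of_lt hst), le_of_lt hsT⟩ hs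

end Segments

/-! ### Local norms of positive definite matrices -/

section LocalNorms

variable {m : Type*} [Fintype m] [DecidableEq m] {A : Matrix m m ℝ}

lemma act_mul (A B : Matrix m m ℝ) (u : EuclideanSpace ℝ m) :
    act (A * B) u = act A (act B u) := by
  rw [act, map_mul]; rfl

lemma act_one (u : EuclideanSpace ℝ m) : act (1 : Matrix m m ℝ) u = u := by
  rw [act, map_one]; rfl

lemma act_conjTranspose (A : Matrix m m ℝ) :
    act A.conjTranspose = ContinuousLinearMap.adjoint (act A) :=
  map_star (Matrix.toEuclideanCLM (𝕜 := ℝ) (n := m)) A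

lemma inner_act_comm (hA : A.IsHermitian) (u v : EuclideanSpace ℝ m) :
    inner ℝ (act A u) v = inner ℝ u (act A v) := by
  have h := act_conjTranspose A
  rw [hA.eq] at h
  conv_lhs => rw [h]
  exact ContinuousLinearMap.adjoint_inner_left _ _ _

lemma norm_act_conjTranspose (A : Matrix m m ℝ) : ‖act A.conjTranspose‖ = ‖act A‖ := by
  rw [act_conjTranspose]
  exact LinearIsometryEquiv.norm_map _ _

lemma posDef_sqrt (hA : A.PosDef) : (CFC.sqrt A).PosDef := by
  have hs : (CFC.sqrt A).PosSemidef := Matrix.nonneg_iff_posSemidef.1 (CFC.sqrt_nonneg A)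
  refine hs.posDef_iff_isUnit.2 ?_
  have h : IsUnit (CFC.sqrt A * CFC.sqrt A) := by
    rw [CFC.sqrt_mul_sqrt_self A hA.posSemidef.nonneg]; exact hA.isUnit
  rw [← sq] at h
  exact (isUnit_pow_iff two_ne_zero).1 h

lemma sqrt_mul_sqrt (hA : A.PosDef) : CFC.sqrt A * CFC.sqrt A = A :=
  CFC.sqrt_mul_sqrt_self A hA.posSemidef.nonneg

lemma sqrt_inv_mul (hA : A.PosDef) : (CFC.sqrt A)⁻¹ * CFC.sqrt A = 1 :=
  Matrix.nonsing_inv_mul _ ((Matrix.isUnit_iff_isUnit_det _).1 (posDef_sqrt hA).isUnit)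

lemma inner_act_eq_inner_sqrt (hA : A.PosDef) (u v : EuclideanSpace ℝ m) :
    inner ℝ u (act A v) = inner ℝ (act (CFC.sqrt A) u) (act (CFC.sqrt A) v) := by
  rw [inner_act_comm (posDef_sqrt hA).1, ← act_mul, sqrt_mul_sqrt hA]

lemma wnorm_nonneg (A : Matrix m m ℝ) (u : EuclideanSpace ℝ m) : 0 ≤ wnorm A u :=
  Real.sqrt_nonneg _

lemma dualNorm_nonneg (A : Matrix m m ℝ) (u : EuclideanSpace ℝ m) : 0 ≤ dualNorm A u :=
  Real.sqrt_nonneg _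

lemma wnorm_eq (hA : A.PosDef) (u : EuclideanSpace ℝ m) :
    wnorm A u = ‖act (CFC.sqrt A) u‖ := by
  rw [wnorm, inner_act_eq_inner_sqrt hA, real_inner_self_eq_norm_sq,
    Real.sqrt_sq (norm_nonneg _)]

lemma wnorm_sq (hA : A.PosDef) (u : EuclideanSpace ℝ m) :
    wnorm A u ^ 2 = inner ℝ u (act A u) := by
  rw [wnorm_eq hA, inner_act_eq_inner_sqrt hA, real_inner_self_eq_norm_sq]

lemma wnorm_smul (hA : A.PosDef) {c : ℝ} (hc : 0 ≤ c) (u : EuclideanSpace ℝ m) :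
    wnorm A (c • u) = c * wnorm A u := by
  rw [wnorm_eq hA, wnorm_eq hA, map_smul, norm_smul, Real.norm_of_nonneg hc]

lemma dualNorm_eq (hA : A.PosDef) (v : EuclideanSpace ℝ m) :
    dualNorm A v = ‖act (CFC.sqrt A)⁻¹ v‖ := by
  have h : A⁻¹ = (CFC.sqrt A)⁻¹ * (CFC.sqrt A)⁻¹ := by
    rw [← Matrix.mul_inv_rev, sqrt_mul_sqrt hA]
  rw [dualNorm, h, act_mul, ← inner_act_comm (posDef_sqrt hA).1.inv, real_inner_self_eq_norm_sq,
    Real.sqrt_sq (norm_nonneg _)]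

lemma act_sqrt_inv_act_sqrt (hA : A.PosDef) (u : EuclideanSpace ℝ m) :
    act (CFC.sqrt A)⁻¹ (act (CFC.sqrt A) u) = u := by
  rw [← act_mul, sqrt_inv_mul hA, act_one]

/-- The Cauchy–Schwarz inequality for a local norm and its dual. -/
lemma abs_inner_le_dualNorm_mul_wnorm (hA : A.PosDef) (v u : EuclideanSpace ℝ m) :
    |inner ℝ v u| ≤ dualNorm A v * wnorm A u := by
  rw [dualNorm_eq hA, wnorm_eq hA]
  have : inner ℝ v u = inner ℝ (act (CFC.sqrt A)⁻¹ v) (act (CFC.sqrt A) u) := by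
    rw [inner_act_comm (posDef_sqrt hA).1.inv, act_sqrt_inv_act_sqrt hA]
  rw [this]
  exact abs_real_inner_le_norm _ _

lemma abs_inner_act_le (hA : A.PosDef) (u v : EuclideanSpace ℝ m) :
    |inner ℝ u (act A v)| ≤ wnorm A u * wnorm A v := by
  rw [inner_act_eq_inner_sqrt hA, wnorm_eq hA, wnorm_eq hA]
  exact abs_real_inner_le_norm _ _

lemma norm_le_mul_wnorm (hA : A.PosDef) (u : EuclideanSpace ℝ m) :
    ‖u‖ ≤ ‖act (CFC.sqrt A)⁻¹‖ * wnorm A u := by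
  conv_lhs => rw [← act_sqrt_inv_act_sqrt hA u]
  rw [wnorm_eq hA]
  exact ContinuousLinearMap.le_opNorm _ _

/-- Comparison of the local norms of two positive definite matrices. -/
lemma wnorm_le_mul_wnorm {B : Matrix m m ℝ} (hA : A.PosDef) (hB : B.PosDef)
    (u : EuclideanSpace ℝ m) :
    wnorm B u ≤ ‖act (CFC.sqrt B * (CFC.sqrt A)⁻¹)‖ * wnorm A u := by
  rw [wnorm_eq hA, wnorm_eq hB]
  conv_lhs => rw [← act_sqrt_inv_act_sqrt hA u]
  rw [← act_mul]
  exact ContinuousLinearMap.le_opNorm _ _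

lemma norm_act_sqrt_mul_inv {B : Matrix m m ℝ} (hA : A.PosDef) (hB : B.PosDef) :
    ‖act (CFC.sqrt A * (CFC.sqrt B)⁻¹)‖ = ‖act ((CFC.sqrt B)⁻¹ * CFC.sqrt A)‖ := by
  rw [← norm_act_conjTranspose, Matrix.conjTranspose_mul, (posDef_sqrt hA).1.eq,
    (posDef_sqrt hB).1.inv.eq]

lemma spectrum_nonneg_of_posDef (hA : A.PosDef) : ∀ x ∈ spectrum ℝ A, 0 ≤ x := fun _ hx =>
  spectrum_nonneg_of_nonneg hA.posSemidef.nonneg hx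

lemma minEigenvalue_nonneg (hA : A.PosDef) : 0 ≤ minEigenvalue A :=
  Real.sInf_nonneg (spectrum_nonneg_of_posDef hA)

lemma minEigenvalue_mul_norm_sq_le (hA : A.PosDef) (u : EuclideanSpace ℝ m) :
    minEigenvalue A * ‖u‖ ^ 2 ≤ wnorm A u ^ 2 := by
  have h1 : algebraMap ℝ (Matrix m m ℝ) (minEigenvalue A) ≤ A :=
    (algebraMap_le_iff_le_spectrum (a := A) hA.1.isSelfAdjoint).2 fun x hx =>
      csInf_le ⟨0, fun y hy => spectrum_nonneg_of_posDef hA y hy⟩ hx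
  have h2 := (Matrix.le_iff.1 h1).dotProduct_mulVec_nonneg (WithLp.ofLp u)
  rw [star_trivial, ← Matrix.inner_toEuclideanCLM _ u u] at h2
  rw [map_sub, _root_.sub_apply, inner_sub_right, Algebra.algebraMap_eq_smul_one,
    map_smul, map_one] at h2
  simp only [_root_.smul_apply, one_apply_eq_self,
    inner_smul_right, real_inner_self_eq_norm_sq] at h2
  rw [wnorm_sq hA]
  linarith

end LocalNorms

/-! ### The Hessian and the gradient as matrix and vector -/

section Hessian

lemma inner_grad {m : Type*} [Fintype m] (f : EuclideanSpace ℝ m → EReal)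
    (x u : EuclideanSpace ℝ m) :
    inner ℝ (grad f x) u = fderiv ℝ (fun y => (f y).toReal) x u := by
  rw [grad, gradient, InnerProductSpace.toDual_symm_apply]

variable {m : Type*} [Fintype m] [DecidableEq m] {f : EuclideanSpace ℝ m → EReal}

lemma euclideanSpace_eq_sum (u : EuclideanSpace ℝ m) :
    u = ∑ a, u a • EuclideanSpace.single a (1 : ℝ) := by
  ext b
  simp [Pi.single_apply]

lemma inner_act_hess (f : EuclideanSpace ℝ m → EReal) (x u v : EuclideanSpace ℝ m) :
    inner ℝ u (act (hess f x) v) = fderiv ℝ (fderiv ℝ fun y => (f y).toReal) x u v := by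
  rw [Matrix.inner_toEuclideanCLM]
  conv_rhs => rw [euclideanSpace_eq_sum u, euclideanSpace_eq_sum v]
  simp only [map_sum, map_smul, _root_.sum_apply, _root_.smul_apply,
    dotProduct, Matrix.mulVec, hess, Matrix.of_apply, smul_eq_mul, Finset.mul_sum]
  rw [Finset.sum_comm]
  refine Finset.sum_congr rfl fun b _ => Finset.sum_congr rfl fun a _ => ?_
  ring

/-- Lower bound on a self-concordant function by its linearization and `ω`. -/
lemma IsSelfConcordant.add_inner_add_omega_le (hf : IsSelfConcordant f 2)
    {x y : EuclideanSpace ℝ m} (hx : x ∈ dom f) (hy : y ∈ dom f) :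
    (f x).toReal + inner ℝ (grad f x) (y - x) + omega (wnorm (hess f x) (y - x))
      ≤ (f y).toReal := by
  have h := (hf.bounds (u := y - x) hx zero_le_one (by simpa using hy) rfl).1
  rw [← inner_act_hess, ← inner_grad] at h
  simpa [wnorm] using h

/-- Inside the Dikin ellipsoid `f` is finite and bounded by its linearization and `ω_*`. -/
lemma IsSelfConcordant.le_add_inner_add_omegaStar (hf : IsSelfConcordant f 2)
    {x u : EuclideanSpace ℝ m} (hx : x ∈ dom f) (hu : wnorm (hess f x) u < 1) :
    x + u ∈ dom f ∧ (f (x + u)).toReal ≤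
      (f x).toReal + inner ℝ (grad f x) u + omegaStar (wnorm (hess f x) u) := by
  rw [wnorm, inner_act_hess] at hu
  have hd : x + u ∈ dom f := by
    simpa using hf.dikin (u := u) hx zero_le_one (by simpa using hu)
  have h := (hf.bounds (u := u) hx zero_le_one (by simpa using hd) rfl).2 (by simpa using hu)
  refine ⟨hd, ?_⟩
  rw [wnorm, inner_act_hess, inner_grad]
  simpa using h

end Hessian

/-! ### Blocks -/

section BlockAlgebra

variable {n : ℕ} {N : Fin n → ℕ}

@[simp] lemma block_apply (i : Fin n) (x : Space N) (l : Fin (N i)) : block i x l = x ⟨i, l⟩ := rfl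

lemma block_add (i : Fin n) (x y : Space N) : block i (x + y) = block i x + block i y := rfl

lemma block_sub (i : Fin n) (x y : Space N) : block i (x - y) = block i x - block i y := rfl

lemma block_neg (i : Fin n) (x : Space N) : block i (-x) = -block i x := rfl

lemma continuous_block (i : Fin n) : Continuous (block i : Space N → Block N i) := by
  unfold block
  fun_prop

lemma inner_eq_sum_block (u v : Space N) :
    inner ℝ u v = ∑ i, inner ℝ (block i u) (block i v) := by
  simp only [PiLp.inner_apply, Fintype.sum_sigma, block_apply]

lemma block_act_blockDiagonal (M : ∀ i : Fin n, Matrix (Fin (N i)) (Fin (N i)) ℝ) (i : Fin n)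
    (d : Space N) : block i (act (Matrix.blockDiagonal' M) d) = act (M i) (block i d) := by
  ext l
  simp only [block_apply, Matrix.ofLp_toEuclideanCLM, Matrix.mulVec, dotProduct,
    Fintype.sum_sigma]
  rw [Finset.sum_eq_single i]
  · simp [Matrix.blockDiagonal'_apply_eq]
  · intro j _ hj
    refine Finset.sum_eq_zero fun l' _ => ?_
    rw [Matrix.blockDiagonal'_apply_ne _ _ _ hj.symm, zero_mul]
  · simp

lemma posDef_diagBlock {A : Matrix (Σ i : Fin n, Fin (N i)) (Σ i : Fin n, Fin (N i)) ℝ}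
    (hA : A.PosDef) (i : Fin n) : (diagBlock A i).PosDef :=
  hA.submatrix fun a b h => by simpa using h

lemma posDef_blockDiagonal {M : ∀ i : Fin n, Matrix (Fin (N i)) (Fin (N i)) ℝ}
    (hM : ∀ i, (M i).PosDef) : (Matrix.blockDiagonal' M).PosDef := by
  refine .of_dotProduct_mulVec_pos ?_ fun x hx => ?_
  · rw [Matrix.IsHermitian, Matrix.blockDiagonal'_conjTranspose]
    exact congrArg _ (funext fun i => (hM i).1)
  · obtain ⟨⟨i, l⟩, hil⟩ := Function.ne_iff.1 hx
    rw [star_trivial]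
    change 0 < (WithLp.ofLp (WithLp.toLp 2 x)) ⬝ᵥ _
    rw [← Matrix.inner_toEuclideanCLM (Matrix.blockDiagonal' M) (WithLp.toLp 2 x)
      (WithLp.toLp 2 x), inner_eq_sum_block]
    simp only [block_act_blockDiagonal]
    refine Finset.sum_pos' (fun j _ => ?_) ⟨i, Finset.mem_univ i, ?_⟩
    · rw [← wnorm_sq (hM j)]; positivity
    · rw [Matrix.inner_toEuclideanCLM]
      have := (hM i).dotProduct_mulVec_pos (x := WithLp.ofLp (block i (WithLp.toLp 2 x)))
        (fun h => hil (congrFun h l))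
      simpa using this

lemma posDef_blockHess {f : Space N → EReal} {x : Space N} (h : (hess f x).PosDef) :
    (blockHess f x).PosDef :=
  posDef_blockDiagonal fun i => posDef_diagBlock h i

lemma wnorm_blockHess_sq {f : Space N → EReal} {x : Space N} (h : (hess f x).PosDef)
    (d : Space N) :
    wnorm (blockHess f x) d ^ 2 = ∑ i, wnorm (diagBlock (hess f x) i) (block i d) ^ 2 := by
  rw [wnorm_sq (posDef_blockHess h), inner_eq_sum_block]
  refine Finset.sum_congr rfl fun i _ => ?_
  rw [wnorm_sq (posDef_diagBlock h i), blockHess, block_act_blockDiagonal]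

/-- The inclusion of the `i`-th block, i.e. `y ↦ (0, …, y, …, 0)`. -/
def blockIncl (i : Fin n) (y : Block N i) : Space N :=
  WithLp.toLp 2 fun a => if h : a.1 = i then y (h ▸ a.2) else 0

lemma block_blockIncl_same (i : Fin n) (y : Block N i) : block i (blockIncl i y) = y := by
  ext l
  simp [blockIncl]

lemma block_blockIncl_ne {i j : Fin n} (h : j ≠ i) (y : Block N i) :
    block j (blockIncl i y) = 0 := by
  ext l
  simp [blockIncl, h]

lemma inner_blockIncl (u : Space N) (i : Fin n) (y : Block N i) :
    inner ℝ u (blockIncl i y) = inner ℝ (block i u) y := by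
  rw [inner_eq_sum_block, Finset.sum_eq_single i]
  · rw [block_blockIncl_same]
  · intro j _ hj
    rw [block_blockIncl_ne hj, inner_zero_right]
  · simp

lemma wnorm_blockIncl (A : Matrix (Σ i : Fin n, Fin (N i)) (Σ i : Fin n, Fin (N i)) ℝ)
    (i : Fin n) (y : Block N i) : wnorm A (blockIncl i y) = wnorm (diagBlock A i) y := by
  unfold wnorm
  congr 1
  rw [real_inner_comm, inner_blockIncl, real_inner_comm]
  congr 1
  ext l
  simp only [block_apply, Matrix.ofLp_toEuclideanCLM, Matrix.mulVec, dotProduct,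
    Fintype.sum_sigma, diagBlock, Matrix.submatrix_apply]
  rw [Finset.sum_eq_single i]
  · simp [blockIncl]
  · intro j _ hj
    simp [blockIncl, hj]
  · simp

lemma dampedStep_eq (f : Space N → EReal) (x : Space N) (i : Fin n) (d : Space N) :
    dampedStep f x i d =
      x + blockIncl i ((1 + blockLambda f x i (block i d))⁻¹ • block i d) := by
  ext ⟨j, l⟩
  by_cases h : j = i
  · subst h
    simp [dampedStep, blockIncl, div_eq_inv_mul]
  · simp [dampedStep, blockIncl, h]

end BlockAlgebra

/-! ### Extended-real sums and the composite objective -/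

lemma ereal_sum_eq_coe {ι : Type*} (s : Finset ι) {a : ι → EReal}
    (ht : ∀ i ∈ s, a i ≠ ⊤) (hb : ∀ i ∈ s, a i ≠ ⊥) :
    ∑ i ∈ s, a i = ((∑ i ∈ s, (a i).toReal : ℝ) : EReal) := by
  classical
  induction s using Finset.induction_on with
  | empty => simp
  | insert j s hj ih =>
    rw [Finset.sum_insert hj, Finset.sum_insert hj, EReal.coe_add,
      ih (fun i hi => ht i (Finset.mem_insert_of_mem hi))
        (fun i hi => hb i (Finset.mem_insert_of_mem hi)),
      EReal.coe_toReal (ht j (Finset.mem_insert_self j s)) (hb j (Finset.mem_insert_self j s))]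

lemma ereal_sum_ne_bot {ι : Type*} (s : Finset ι) {a : ι → EReal} (hb : ∀ i, a i ≠ ⊥) :
    ∑ i ∈ s, a i ≠ ⊥ := by
  classical
  induction s using Finset.induction_on with
  | empty => simp
  | insert j s hj ih =>
    rw [Finset.sum_insert hj, Ne, EReal.add_eq_bot_iff]
    exact fun h => h.elim (hb j) ih

lemma ereal_sum_ne_top_iff {ι : Type*} (s : Finset ι) {a : ι → EReal} (hb : ∀ i, a i ≠ ⊥) :
    ∑ i ∈ s, a i ≠ ⊤ ↔ ∀ i ∈ s, a i ≠ ⊤ := by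
  classical
  induction s using Finset.induction_on with
  | empty => simp
  | insert j s hj ih =>
    rw [Finset.sum_insert hj, Finset.forall_mem_insert, ← ih]
    constructor
    · intro h
      refine ⟨fun hj => h ?_, fun hs => h ?_⟩
      · rw [hj, EReal.top_add_of_ne_bot (ereal_sum_ne_bot s hb)]
      · rw [hs, EReal.add_top_of_ne_bot (hb j)]
    · rintro ⟨h1, h2⟩
      exact EReal.add_ne_top h1 h2

section Subgradient

variable {V : Type*} [NormedAddCommGroup V] [InnerProductSpace ℝ V] {h : V → EReal}

lemma toReal_add_inner_le (hb : ∀ x, h x ≠ ⊥) {x y s : V} (hs : s ∈ subdiff h x)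
    (hy : h y ≠ ⊤) : (h x).toReal + inner ℝ s (y - x) ≤ (h y).toReal := by
  have h1 := hs.2 y
  rw [← EReal.coe_toReal hs.1 (hb x), ← EReal.coe_toReal hy (hb y), ← EReal.coe_add] at h1
  exact EReal.coe_le_coe_iff.1 h1

lemma IsProperClosedConvex.line (hg : IsProperClosedConvex h) {x d : V} {t : ℝ} (ht : 0 ≤ t)
    (ht1 : t ≤ 1) (hx : h x ≠ ⊤) (hd : h (x + d) ≠ ⊤) :
    h (x + t • d) ≠ ⊤ ∧
      (h (x + t • d)).toReal ≤ (h x).toReal + t * ((h (x + d)).toReal - (h x).toReal) := by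
  have e : x + t • d = (1 - t) • x + t • (x + d) := by module
  rw [e]
  refine ⟨hg.convex.1 hx hd (by linarith) ht (by ring), ?_⟩
  have := hg.convex.2 hx hd (by linarith : 0 ≤ 1 - t) ht (by ring)
  simp only [smul_eq_mul] at this
  linarith

/-- First-order condition for a lower bound on the right of `0`. -/
lemma le_deriv_of_forall_le {φ : ℝ → ℝ} {φ' c : ℝ} (hφ : HasDerivAt φ φ' 0)
    (h : ∀ t, 0 < t → t ≤ 1 → φ 0 + t * c ≤ φ t) : c ≤ φ' := by
  have hlim := hφ.tendsto_slope_zero_right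
  refine ge_of_tendsto hlim ?_
  filter_upwards [self_mem_nhdsWithin, mem_nhdsWithin_of_mem_nhds (Iic_mem_nhds one_pos)]
    with t ht ht1
  have ht0 : (0 : ℝ) < t := ht
  rw [zero_add, smul_eq_mul, ← div_eq_inv_mul, le_div_iff₀ ht0]
  linarith [h t ht0 ht1]

end Subgradient

section Objective

variable {n : ℕ} {N : Fin n → ℕ} {f : Space N → EReal} {g : ∀ i, Block N i → EReal}

/-- The real value of the separable part `g(x) = ∑ i, g_i(x_i)`; meaningful where every
`g_i(x_i)` is finite. -/
def sepReal (g : ∀ i, Block N i → EReal) (x : Space N) : ℝ := ∑ i, (g i (block i x)).toReal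

namespace StandingAssumption

lemma mem_dom_iff (H : StandingAssumption f g) {x : Space N} :
    x ∈ dom (objective f g) ↔ x ∈ dom f ∧ ∀ i, g i (block i x) ≠ ⊤ := by
  have hb : ∀ i, g i (block i x) ≠ ⊥ := fun i => (H.proper_closed_convex i).ne_bot _
  have hs := ereal_sum_ne_top_iff Finset.univ hb
  have hsb := ereal_sum_ne_bot Finset.univ hb
  simp only [Finset.mem_univ, true_implies] at hs
  rw [← hs]
  change f x + _ ≠ ⊤ ↔ f x ≠ ⊤ ∧ _
  constructor
  · intro h
    refine ⟨fun hf => h ?_, fun hg => h ?_⟩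
    · rw [hf, EReal.top_add_of_ne_bot hsb]
    · rw [hg, EReal.add_top_of_ne_bot (H.selfConcordant.ne_bot x)]
  · rintro ⟨h1, h2⟩
    exact EReal.add_ne_top h1 h2

lemma objective_ne_bot (H : StandingAssumption f g) (x : Space N) : objective f g x ≠ ⊥ := by
  rw [objective, Ne, EReal.add_eq_bot_iff]
  exact fun h => h.elim (H.selfConcordant.ne_bot x)
    (ereal_sum_ne_bot _ fun i => (H.proper_closed_convex i).ne_bot _)

lemma sum_eq_sepReal (H : StandingAssumption f g) {x : Space N}
    (hx : ∀ i, g i (block i x) ≠ ⊤) : ∑ i, g i (block i x) = (sepReal g x : EReal) :=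
  ereal_sum_eq_coe _ (fun i _ => hx i) fun i _ => (H.proper_closed_convex i).ne_bot _

lemma toReal_objective (H : StandingAssumption f g) {x : Space N}
    (hx : x ∈ dom (objective f g)) :
    (objective f g x).toReal = (f x).toReal + sepReal g x := by
  obtain ⟨h1, h2⟩ := H.mem_dom_iff.1 hx
  rw [objective, H.sum_eq_sepReal h2]
  conv_lhs => rw [← EReal.coe_toReal h1 (H.selfConcordant.ne_bot x)]
  rw [← EReal.coe_add, EReal.toReal_coe]

lemma sepReal_line (H : StandingAssumption f g) {x d : Space N} {t : ℝ} (ht : 0 ≤ t)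
    (ht1 : t ≤ 1) (hx : ∀ i, g i (block i x) ≠ ⊤) (hd : ∀ i, g i (block i (x + d)) ≠ ⊤) :
    (∀ i, g i (block i (x + t • d)) ≠ ⊤) ∧
      sepReal g (x + t • d) ≤ sepReal g x + t * (sepReal g (x + d) - sepReal g x) := by
  have key := fun i => (H.proper_closed_convex i).line (d := block i d) ht ht1 (hx i) (hd i)
  refine ⟨fun i => (key i).1, ?_⟩
  unfold sepReal
  rw [← Finset.sum_sub_distrib, Finset.mul_sum, ← Finset.sum_add_distrib]
  exact Finset.sum_le_sum fun i _ => (key i).2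

/-- Blockwise subgradients of the `g_i` assemble to a subgradient of the separable part. -/
lemma sepReal_add_inner_le (H : StandingAssumption f g) {w y S : Space N}
    (hS : ∀ i, block i S ∈ subdiff (g i) (block i w)) (hy : ∀ i, g i (block i y) ≠ ⊤) :
    sepReal g w + inner ℝ S (y - w) ≤ sepReal g y := by
  rw [inner_eq_sum_block, sepReal, sepReal, ← Finset.sum_add_distrib]
  exact Finset.sum_le_sum fun i _ =>
    toReal_add_inner_le (H.proper_closed_convex i).ne_bot (hS i) (hy i)

/-! ### Distance to the optimal value and subgradients -/

/-- Subtracting the gradient of the smooth part from a subgradient of `F` at `x` leaves a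
subgradient of the separable part. -/
lemma inner_sub_grad_le (H : StandingAssumption f g) {x y s : Space N}
    (hs : s ∈ subdiff (objective f g) x) (hy : y ∈ dom (objective f g)) :
    inner ℝ (s - grad f x) (y - x) ≤ sepReal g y - sepReal g x := by
  have hx : x ∈ dom (objective f g) := hs.1
  obtain ⟨hxf, hxg⟩ := H.mem_dom_iff.1 hx
  obtain ⟨hyf, hyg⟩ := H.mem_dom_iff.1 hy
  have hd := line_hasDerivAt (h := fun y => (f y).toReal) (x := x) (u := y - x) (t := 0)
    (by simpa using H.selfConcordant.differentiableAt hxf)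
  have := le_deriv_of_forall_le (c := inner ℝ s (y - x) - (sepReal g y - sepReal g x)) hd ?_
  · rw [zero_smul, add_zero, ← inner_grad] at this
    rw [inner_sub_left]; linarith
  · intro t ht ht1
    have hg := H.sepReal_line (d := y - x) ht.le ht1 hxg (by simpa using hyg)
    have hf : x + t • (y - x) ∈ dom f :=
      H.selfConcordant.convex.1.add_smul_sub_mem hxf hyf ⟨ht.le, ht1⟩
    have ht' : x + t • (y - x) ∈ dom (objective f g) := H.mem_dom_iff.2 ⟨hf, hg.1⟩
    have h1 := toReal_add_inner_le H.objective_ne_bot hs ht'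
    rw [H.toReal_objective hx, H.toReal_objective ht', add_sub_cancel_left,
      inner_smul_right] at h1
    have h2 := hg.2
    rw [add_sub_cancel] at h2
    simp only [zero_smul, add_zero]
    linarith

/-- A subgradient of small local norm bounds the gap in function value, by conjugacy of
`ω` and `ω_*`. -/
lemma objective_sub_le_omegaStar (H : StandingAssumption f g) {x y s : Space N}
    (hs : s ∈ subdiff (objective f g) x) (hy : y ∈ dom (objective f g))
    (h1 : dualNorm (hess f x) s < 1) :
    (objective f g x).toReal - (objective f g y).toReal ≤ omegaStar (dualNorm (hess f x) s) := by
  have hx : x ∈ dom (objective f g) := hs.1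
  have hA := H.posDef x hx
  rw [H.toReal_objective hx, H.toReal_objective hy]
  have hf := H.selfConcordant.add_inner_add_omega_le (H.mem_dom_iff.1 hx).1 (H.mem_dom_iff.1 hy).1
  have hg := H.inner_sub_grad_le hs hy
  have hcs := (abs_le.1 (abs_inner_le_dualNorm_mul_wnorm hA s (y - x))).1
  have hfy := mul_le_omega_add_omegaStar (wnorm_nonneg (hess f x) (y - x)) h1
  rw [inner_sub_left] at hg
  linarith

/-! ### Decrease of the objective in one damped step -/

/-- One damped step along an inexact block direction decreases `F` by at least `ω(λ_i) / 2`. -/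
lemma dampedStep_descent (H : StandingAssumption f g) {η : ℝ} (hη : η ≤ 1 / 4)
    {x d : Space N} (hx : x ∈ dom (objective f g)) {i : Fin n}
    (hd : IsApproxBlockDir f g η x i (block i d)) :
    dampedStep f x i d ∈ dom (objective f g) ∧
      (objective f g (dampedStep f x i d)).toReal ≤
        (objective f g x).toReal - 1 / 2 * omega (blockLambda f x i (block i d)) := by
  obtain ⟨v, s, hs, hvs, hv⟩ := hd
  have hA := H.posDef x hx
  have hAi := posDef_diagBlock hA i
  obtain ⟨hxf, hxg⟩ := H.mem_dom_iff.1 hx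
  set l := blockLambda f x i (block i d) with hl
  have hl0 : 0 ≤ l := wnorm_nonneg _ _
  have h1 : 0 < 1 + l := by linarith
  set α := (1 + l)⁻¹ with hα
  have hα0 : 0 ≤ α := (inv_pos.2 h1).le
  have hα1 : α ≤ 1 := inv_le_one_of_one_le₀ (by linarith)
  set u := blockIncl i (α • block i d) with hu
  have hwu : wnorm (hess f x) u = α * l := by
    rw [hu, wnorm_blockIncl, wnorm_smul hAi hα0]; rfl
  have hαl : α * l < 1 := by
    rw [hα, inv_mul_lt_iff₀ h1]; linarith
  obtain ⟨hf1, hf2⟩ := H.selfConcordant.le_add_inner_add_omegaStar (u := u) hxf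
    (by rw [hwu]; exact hαl)
  have hgi := (H.proper_closed_convex i).line (d := block i d) hα0 hα1 (hxg i) hs.1
  have hbi : block i (x + u) = block i x + α • block i d := by
    rw [block_add, hu, block_blockIncl_same]
  have hbj : ∀ j, j ≠ i → block j (x + u) = block j x := fun j hj => by
    rw [block_add, hu, block_blockIncl_ne hj, add_zero]
  have hdom : x + u ∈ dom (objective f g) := by
    refine H.mem_dom_iff.2 ⟨hf1, fun j => ?_⟩
    by_cases hj : j = i
    · subst hj; rw [hbi]; exact hgi.1
    · rw [hbj j hj]; exact hxg j
  have hsep : sepReal g (x + u) ≤ sepReal g x +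
      α * ((g i (block i x + block i d)).toReal - (g i (block i x)).toReal) := by
    unfold sepReal
    rw [← Finset.add_sum_erase _ _ (Finset.mem_univ i),
      ← Finset.add_sum_erase (a := i) Finset.univ (fun i => (g i (block i x)).toReal)
        (Finset.mem_univ i), hbi]
    have : ∑ j ∈ Finset.univ.erase i, (g j (block j (x + u))).toReal =
        ∑ j ∈ Finset.univ.erase i, (g j (block j x)).toReal :=
      Finset.sum_congr rfl fun j hj => by rw [hbj j (Finset.ne_of_mem_erase hj)]
    rw [this]
    linarith [hgi.2]
  have hsub := toReal_add_inner_le (H.proper_closed_convex i).ne_bot hs (hxg i)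
  have hse : s = -v - block i (grad f x) - act (diagBlock (hess f x) i) (block i d) := by
    rw [hvs]; abel
  have hinner : inner ℝ s (block i x - (block i x + block i d)) =
      inner ℝ v (block i d) + inner ℝ (block i (grad f x)) (block i d) + l ^ 2 := by
    rw [hl, blockLambda, wnorm_sq hAi, ← inner_act_comm hAi.1, hse, sub_add_cancel_left,
      inner_neg_right, inner_sub_left, inner_sub_left, inner_neg_left]
    ring
  have hcs := (abs_le.1 (abs_inner_le_dualNorm_mul_wnorm hAi v (block i d))).1
  have hv2 : dualNorm (diagBlock (hess f x) i) v * wnorm (diagBlock (hess f x) i) (block i d)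
      ≤ η * l * l := mul_le_mul_of_nonneg_right hv hl0
  have hgrad : inner ℝ (grad f x) u = α * inner ℝ (block i (grad f x)) (block i d) := by
    rw [hu, inner_blockIncl, inner_smul_right]
  rw [dampedStep_eq]
  change x + u ∈ _ ∧ (objective f g (x + u)).toReal ≤ _
  refine ⟨hdom, ?_⟩
  rw [H.toReal_objective hdom, H.toReal_objective hx]
  rw [hwu, hgrad] at hf2
  have hnum := omegaStar_damped_le hη hl0
  rw [← hα] at hnum
  have hstep : α * ((g i (block i x + block i d)).toReal - (g i (block i x)).toReal) ≤
      α * (-inner ℝ (block i (grad f x)) (block i d) + -(1 - η) * l ^ 2) :=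
    mul_le_mul_of_nonneg_left (by rw [hinner] at hsub; nlinarith) hα0
  linarith

end StandingAssumption

end Objective

/-! ### The exact proximal Newton direction -/

section ProxNewton

variable {n : ℕ} {N : Fin n → ℕ} {f : Space N → EReal} {g : ∀ i, Block N i → EReal}

lemma lowerSemicontinuous_add_of_ne_bot {X : Type*} [TopologicalSpace X] {a b : X → EReal}
    (ha : LowerSemicontinuous a) (hb : LowerSemicontinuous b)
    (ha' : ∀ x, a x ≠ ⊥) (hb' : ∀ x, b x ≠ ⊥) : LowerSemicontinuous fun x => a x + b x :=
  ha.add' hb fun x => EReal.continuousAt_add (Or.inr (hb' x)) (Or.inl (ha' x))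

lemma lowerSemicontinuous_sum_of_ne_bot {X ι : Type*} [TopologicalSpace X] (s : Finset ι)
    {a : ι → X → EReal} (ha : ∀ i, LowerSemicontinuous (a i)) (ha' : ∀ i x, a i x ≠ ⊥) :
    LowerSemicontinuous fun x => ∑ i ∈ s, a i x := by
  classical
  induction s using Finset.induction_on with
  | empty => simpa using (continuous_const (y := (0 : EReal))).lowerSemicontinuous
  | insert j s hj ih =>
    simp only [Finset.sum_insert hj]
    exact lowerSemicontinuous_add_of_ne_bot (ha j) ih (ha' j)
      fun x => ereal_sum_ne_bot s fun i => ha' i x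

namespace StandingAssumption

lemma lowerSemicontinuous_sep (H : StandingAssumption f g) (x : Space N) :
    LowerSemicontinuous fun e : Space N => ∑ i, g i (block i (x + e)) :=
  lowerSemicontinuous_sum_of_ne_bot _
    (fun i => LowerSemicontinuous.comp (H.proper_closed_convex i).closed
      ((continuous_block i).comp (continuous_const.add continuous_id)))
    fun i _ => (H.proper_closed_convex i).ne_bot _

lemma lowerSemicontinuous_objective (H : StandingAssumption f g) :
    LowerSemicontinuous (objective f g) := by
  have h := H.lowerSemicontinuous_sep 0
  simp only [zero_add] at h
  exact lowerSemicontinuous_add_of_ne_bot H.selfConcordant.closed h H.selfConcordant.ne_bot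
    fun x => ereal_sum_ne_bot _ fun i => (H.proper_closed_convex i).ne_bot _

lemma model_eq_coe (H : StandingAssumption f g) {x e : Space N} (hx : x ∈ dom f)
    (he : ∀ i, g i (block i (x + e)) ≠ ⊤) (r : ℝ) :
    f x + (r : EReal) + ∑ i, g i (block i (x + e)) =
      (((f x).toReal + r + sepReal g (x + e) : ℝ) : EReal) := by
  rw [H.sum_eq_sepReal he]
  conv_lhs => rw [← EReal.coe_toReal hx (H.selfConcordant.ne_bot x)]
  push_cast
  rfl

lemma model_ne_top_iff (H : StandingAssumption f g) {x e : Space N} (hx : x ∈ dom f) (r : ℝ) :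
    f x + (r : EReal) + ∑ i, g i (block i (x + e)) ≠ ⊤ ↔ ∀ i, g i (block i (x + e)) ≠ ⊤ := by
  constructor
  · intro h
    have hb : ∀ i, g i (block i (x + e)) ≠ ⊥ := fun i => (H.proper_closed_convex i).ne_bot _
    have := (ereal_sum_ne_top_iff Finset.univ hb).1 fun hs => h ?_
    · simpa using this
    · rw [hs, EReal.add_top_of_ne_bot]
      rw [Ne, EReal.add_eq_bot_iff]
      exact fun h => h.elim (H.selfConcordant.ne_bot x) (EReal.coe_ne_bot r)
  · intro h
    rw [H.model_eq_coe hx h]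
    exact EReal.coe_ne_top _

/-- Existence of the proximal Newton direction. A subgradient of the separable part at any point
gives an affine minorant, so the model is coercive. -/
lemma exists_isProxNewtonDir (H : StandingAssumption f g) {x w S : Space N}
    (hx : x ∈ dom (objective f g)) (hS : ∀ i, block i S ∈ subdiff (g i) (block i w)) :
    ∃ d, IsProxNewtonDir f g x d := by
  have hA := H.posDef x hx
  obtain ⟨hxf, hxg⟩ := H.mem_dom_iff.1 hx
  set A := hess f x
  set q : Space N → ℝ := fun e => inner ℝ (grad f x) e + 1 / 2 * inner ℝ e (act A e) with hq
  set Ψ : Space N → EReal := fun e => f x + ((q e : ℝ) : EReal) + ∑ i, g i (block i (x + e))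
    with hΨ
  have hlsc : LowerSemicontinuous Ψ := by
    have hqc : Continuous q := by fun_prop
    refine lowerSemicontinuous_add_of_ne_bot ?_ (H.lowerSemicontinuous_sep x) ?_ ?_
    · exact lowerSemicontinuous_add_of_ne_bot
        (continuous_const (y := f x)).lowerSemicontinuous
        (continuous_coe_real_ereal.comp hqc).lowerSemicontinuous
        (fun _ => H.selfConcordant.ne_bot x) fun _ => EReal.coe_ne_bot _
    · intro e
      rw [Ne, EReal.add_eq_bot_iff]
      exact fun h => h.elim (H.selfConcordant.ne_bot x) (EReal.coe_ne_bot _)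
    · exact fun e => ereal_sum_ne_bot _ fun i => (H.proper_closed_convex i).ne_bot _
  have hx0 : ∀ i, g i (block i (x + 0)) ≠ ⊤ := by simpa using hxg
  have hΨ0 : Ψ 0 = (((f x).toReal + q 0 + sepReal g (x + 0) : ℝ) : EReal) :=
    H.model_eq_coe hxf hx0 _
  have hq0 : q 0 = 0 := by simp [hq]
  -- On `{Ψ ≤ Ψ 0}` the local norm `r` of `e` satisfies `r² / 2 ≤ B r + C`.
  set K := ‖act (CFC.sqrt A)⁻¹‖
  set B := ‖grad f x + S‖ * K
  set C := |sepReal g x - (sepReal g w + inner ℝ S (x - w))|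
  have hB : 0 ≤ B := by positivity
  have hC : 0 ≤ C := abs_nonneg _
  set R := 1 + 2 * B + 2 * C
  have hbound : ∀ e, Ψ e ≤ Ψ 0 → ‖e‖ ≤ K * R := by
    intro e he
    have het : ∀ i, g i (block i (x + e)) ≠ ⊤ := by
      refine (H.model_ne_top_iff hxf (q e)).1 (ne_of_lt (lt_of_le_of_lt he ?_))
      rw [hΨ0]; exact EReal.coe_lt_top _
    have he' : ((f x).toReal + q e + sepReal g (x + e) : ℝ) ≤
        (f x).toReal + q 0 + sepReal g (x + 0) := by
      rw [hΨ0] at he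
      have h1 : Ψ e = _ := H.model_eq_coe hxf het (q e)
      rw [h1] at he
      exact EReal.coe_le_coe_iff.1 he
    rw [hq0, add_zero, add_zero] at he'
    have hmin := H.sepReal_add_inner_le hS het
    set r := wnorm A e with hr
    have hr0 : 0 ≤ r := wnorm_nonneg _ _
    have hK : ‖e‖ ≤ K * r := norm_le_mul_wnorm hA e
    have hqe : q e = inner ℝ (grad f x) e + 1 / 2 * r ^ 2 := by
      rw [hr, wnorm_sq hA]
    have hin : -(B * r) ≤ inner ℝ (grad f x + S) e := by
      have h1 := (abs_le.1 (abs_real_inner_le_norm (grad f x + S) e)).1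
      have h2 : ‖grad f x + S‖ * ‖e‖ ≤ ‖grad f x + S‖ * (K * r) :=
        mul_le_mul_of_nonneg_left hK (norm_nonneg _)
      have h3 : ‖grad f x + S‖ * (K * r) = B * r := by simp only [B]; ring
      linarith
    have hSe : inner ℝ S (x + e - w) = inner ℝ S (x - w) + inner ℝ S e := by
      rw [← inner_add_right]; congr 1; abel
    have hCle := le_abs_self (sepReal g x - (sepReal g w + inner ℝ S (x - w)))
    rw [inner_add_left] at hin
    have hquad : r ^ 2 / 2 ≤ B * r + C := by
      simp only [C]; linarith
    have hrR : r ≤ R := by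
      by_contra! hlt
      have h1 : 1 < r := by simp only [R] at hlt; linarith
      have h2 : C ≤ C * r := le_mul_of_one_le_right hC h1.le
      have h3 : R * r ≤ r * r := mul_le_mul_of_nonneg_right hlt.le hr0
      simp only [R] at h3
      nlinarith
    exact hK.trans (mul_le_mul_of_nonneg_left hrR (norm_nonneg _))
  have hKR : 0 ≤ K * R := by positivity
  obtain ⟨d, hd, hmin⟩ := (hlsc.lowerSemicontinuousOn (Metric.closedBall 0 (K * R))).exists_isMinOn
    ⟨0, by simpa using hKR⟩ (isCompact_closedBall _ _)
  refine ⟨d, fun e _ => ?_⟩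
  change Ψ d ≤ Ψ e
  have hd0 : Ψ d ≤ Ψ 0 := hmin (by simpa using hKR)
  by_cases he : Ψ e ≤ Ψ 0
  · exact hmin (by simpa using hbound e he)
  · exact hd0.trans (not_le.1 he).le

lemma isProxNewtonDir_finite (H : StandingAssumption f g) {x d : Space N}
    (hx : x ∈ dom (objective f g)) (hd : IsProxNewtonDir f g x d) :
    ∀ i, g i (block i (x + d)) ≠ ⊤ := by
  obtain ⟨hxf, hxg⟩ := H.mem_dom_iff.1 hx
  refine (H.model_ne_top_iff hxf
    (inner ℝ (grad f x) d + 1 / 2 * inner ℝ d (act (hess f x) d))).1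
    (ne_of_lt (lt_of_le_of_lt (hd (Set.mem_univ (0 : Space N))) ?_))
  have hx0 : ∀ i, g i (block i (x + 0)) ≠ ⊤ := by simpa using hxg
  beta_reduce
  rw [H.model_eq_coe hxf hx0]
  exact EReal.coe_lt_top _

/-- The variational inequality that characterizes the proximal Newton direction. -/
lemma isProxNewtonDir_variational (H : StandingAssumption f g) {x d e : Space N}
    (hx : x ∈ dom (objective f g)) (hd : IsProxNewtonDir f g x d)
    (he : ∀ i, g i (block i (x + e)) ≠ ⊤) :
    sepReal g (x + d) - sepReal g (x + e) ≤
      inner ℝ (grad f x + act (hess f x) d) (e - d) := by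
  have hA := H.posDef x hx
  obtain ⟨hxf, hxg⟩ := H.mem_dom_iff.1 hx
  have hdg := H.isProxNewtonDir_finite hx hd
  set A := hess f x
  have hder : HasDerivAt (fun t : ℝ => t * inner ℝ (grad f x + act A d) (e - d) +
      t ^ 2 * (1 / 2 * inner ℝ (e - d) (act A (e - d))))
      (inner ℝ (grad f x + act A d) (e - d)) 0 := by
    have h1 := ((hasDerivAt_id' (0 : ℝ)).mul_const
      (inner ℝ (grad f x + act A d) (e - d))).fun_add
      (((hasDerivAt_id' (0 : ℝ)).fun_pow 2).mul_const (1 / 2 * inner ℝ (e - d) (act A (e - d))))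
    exact h1.congr_deriv (by simp)
  refine le_deriv_of_forall_le hder fun t ht ht1 => ?_
  have hed : x + d + (e - d) = x + e := by abel
  have hl := H.sepReal_line (d := e - d) ht.le ht1 hdg (by rw [hed]; exact he)
  rw [hed, add_assoc] at hl
  have hm := hd (Set.mem_univ (d + t • (e - d)))
  simp only [Set.mem_ofPred_eq] at hm
  rw [H.model_eq_coe hxf hl.1, H.model_eq_coe hxf hdg, EReal.coe_le_coe_iff] at hm
  have hexp : inner ℝ (d + t • (e - d)) (act A (d + t • (e - d))) =
      inner ℝ d (act A d) + 2 * t * inner ℝ (act A d) (e - d) +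
        t ^ 2 * inner ℝ (e - d) (act A (e - d)) := by
    have hsym : inner ℝ d (act A (e - d)) = inner ℝ (act A d) (e - d) :=
      (inner_act_comm hA.1 _ _).symm
    have hsym' : inner ℝ (e - d) (act A d) = inner ℝ (act A d) (e - d) := real_inner_comm _ _
    simp only [map_add, map_smul, inner_add_left, inner_add_right, inner_smul_left,
      inner_smul_right, hsym, hsym', RCLike.conj_to_real]
    ring
  rw [hexp, inner_add_right, inner_smul_right] at hm
  rw [inner_add_left]
  have := hl.2
  nlinarith

/-- The local norm of the exact proximal Newton direction is controlled by the inexact block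
directions: combine the variational inequality with monotonicity of `∂g`. -/
lemma wnorm_proxNewton_le (H : StandingAssumption f g) {η : ℝ} (hη0 : 0 ≤ η) (hη1 : η ≤ 1)
    {x d d' : Space N} (hx : x ∈ dom (objective f g))
    (hd : ∀ i, IsApproxBlockDir f g η x i (block i d)) (hd' : IsProxNewtonDir f g x d') :
    wnorm (hess f x) d' ≤ blockCond f η x * wnorm (blockHess f x) d := by
  have hA := H.posDef x hx
  have hH := posDef_blockHess hA
  choose v s hs hvs hv using hd
  set S : Space N := WithLp.toLp 2 fun a => s a.1 a.2
  set W : Space N := WithLp.toLp 2 fun a => v a.1 a.2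
  have hSb : ∀ i, block i S = s i := fun i => rfl
  have hWb : ∀ i, block i W = v i := fun i => rfl
  have hdg : ∀ i, g i (block i (x + d)) ≠ ⊤ := fun i => (hs i).1
  have hS : S = -W - grad f x - act (blockHess f x) d := by
    have : ∀ i, block i S = block i (-W - grad f x - act (blockHess f x) d) := by
      intro i
      rw [block_sub, block_sub, block_neg, hSb, hWb, blockHess, block_act_blockDiagonal, hvs]
      abel
    ext ⟨i, l⟩
    exact congrArg (fun y : Block N i => y l) (this i)
  set A := hess f x
  set a := wnorm A d' with ha
  set b := wnorm (blockHess f x) d with hb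
  have ha0 : 0 ≤ a := wnorm_nonneg _ _
  have hb0 : 0 ≤ b := wnorm_nonneg _ _
  have h1 := H.sepReal_add_inner_le (w := x + d) (S := S) (fun i => hs i)
    (H.isProxNewtonDir_finite hx hd')
  have h2 := H.isProxNewtonDir_variational hx hd' hdg
  rw [add_sub_add_left_eq_sub] at h1
  have hdd : inner ℝ d (act (blockHess f x) d) = b ^ 2 := (wnorm_sq hH d).symm
  have hdd' : inner ℝ d' (act A d') = a ^ 2 := (wnorm_sq hA d').symm
  -- `⟨v, y⟩ ≤ η ‖d‖_H ‖y‖_H`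
  have hW : ∀ y : Space N, |inner ℝ W y| ≤ η * b * wnorm (blockHess f x) y := by
    intro y
    rw [inner_eq_sum_block]
    calc |∑ i, inner ℝ (block i W) (block i y)|
        ≤ ∑ i, |inner ℝ (block i W) (block i y)| := Finset.abs_sum_le_sum_abs _ _
      _ ≤ ∑ i, η * (wnorm (diagBlock A i) (block i d) * wnorm (diagBlock A i) (block i y)) := by
          refine Finset.sum_le_sum fun i _ => ?_
          refine (abs_inner_le_dualNorm_mul_wnorm (posDef_diagBlock hA i) _ _).trans ?_
          rw [← mul_assoc]
          exact mul_le_mul_of_nonneg_right (hv i) (wnorm_nonneg _ _)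
      _ ≤ η * (b * wnorm (blockHess f x) y) := by
          rw [← Finset.mul_sum]
          refine mul_le_mul_of_nonneg_left ?_ hη0
          refine abs_le_of_sq_le_sq' ?_ (mul_nonneg hb0 (wnorm_nonneg _ _)) |>.2
          rw [mul_pow, hb, wnorm_blockHess_sq hA, wnorm_blockHess_sq hA]
          exact Finset.sum_mul_sq_le_sq_mul_sq _ _ _
      _ = η * b * wnorm (blockHess f x) y := by ring
  have hWd := (abs_le.1 (hW d)).1
  have hWd' := (abs_le.1 (hW d')).2
  have hAd := (abs_le.1 (abs_inner_act_le hA d d')).2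
  have hHd := (abs_le.1 (abs_inner_act_le hH d' d)).2
  have hcA : wnorm A d ≤ ‖act ((CFC.sqrt (blockHess f x))⁻¹ * CFC.sqrt A)‖ * b := by
    rw [← norm_act_sqrt_mul_inv hA hH]
    exact wnorm_le_mul_wnorm hH hA d
  have hcH : wnorm (blockHess f x) d' ≤ ‖act (CFC.sqrt (blockHess f x) * (CFC.sqrt A)⁻¹)‖ * a :=
    wnorm_le_mul_wnorm hA hH d'
  set k₁ := ‖act (CFC.sqrt (blockHess f x) * (CFC.sqrt A)⁻¹)‖
  set k₂ := ‖act ((CFC.sqrt (blockHess f x))⁻¹ * CFC.sqrt A)‖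
  have hmono : a ^ 2 ≤ wnorm A d * a + (b * wnorm (blockHess f x) d' + η * b *
      wnorm (blockHess f x) d') := by
    rw [hS] at h1
    have e1 : inner ℝ (-W - grad f x - act (blockHess f x) d) (d' - d) =
        -inner ℝ W d' - inner ℝ (grad f x) d' - inner ℝ d' (act (blockHess f x) d)
          + inner ℝ W d + inner ℝ (grad f x) d + b ^ 2 := by
      rw [← hdd, real_inner_comm _ d', real_inner_comm _ d]
      simp only [inner_sub_left, inner_sub_right, inner_neg_left]
      ring
    have e2 : inner ℝ (grad f x + act A d') (d - d') =
        inner ℝ (grad f x) d - inner ℝ (grad f x) d' + inner ℝ d (act A d') - a ^ 2 := by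
      rw [← hdd', real_inner_comm _ d', real_inner_comm _ d]
      simp only [inner_add_left, inner_sub_right]
      ring
    rw [e1] at h1
    rw [e2] at h2
    have hb2 : η * b ^ 2 ≤ 1 * b ^ 2 := mul_le_mul_of_nonneg_right hη1 (sq_nonneg b)
    nlinarith
  have hfin : a ^ 2 ≤ (blockCond f η x * b) * a := by
    have h3 : wnorm A d * a ≤ k₂ * b * a := mul_le_mul_of_nonneg_right hcA ha0
    have h4 : (1 + η) * b * wnorm (blockHess f x) d' ≤ (1 + η) * b * (k₁ * a) :=
      mul_le_mul_of_nonneg_left hcH (by positivity)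
    have e : blockCond f η x = (1 + η) * k₁ + k₂ := rfl
    rw [e]
    linarith
  rcases ha0.eq_or_lt with h0 | h0
  · rw [← h0]
    have : 0 ≤ blockCond f η x := by unfold blockCond; positivity
    positivity
  · rw [sq] at hfin
    exact le_of_mul_le_mul_right hfin h0

end StandingAssumption

end ProxNewton

/-! ### Expected decrease at a point of the level set -/

section ExpectedDecrease

variable {n : ℕ} {N : Fin n → ℕ} {f : Space N → EReal} {g : ∀ i, Block N i → EReal}
  {x₀ : Space N}

lemma blockCond_nonneg {η : ℝ} (hη : 0 ≤ η) (f : Space N → EReal) (x : Space N) :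
    0 ≤ blockCond f η x := by
  unfold blockCond; positivity

lemma sSup_blockCond_nonneg {η : ℝ} (hη : 0 ≤ η) (s : Set (Space N)) :
    0 ≤ sSup (blockCond f η '' s) :=
  Real.sSup_nonneg (by rintro _ ⟨x, -, rfl⟩; exact blockCond_nonneg hη f x)

lemma c4_nonneg {η c₃ : ℝ} (hη0 : 0 ≤ η) (hη1 : η ≤ 1) (hc₃ : 0 ≤ c₃) :
    0 ≤ c4 f g x₀ η c₃ := by
  have h := sSup_blockCond_nonneg (f := f) hη0 (levelSet f g x₀)
  have h1 : 0 ≤ 1 - η := by linarith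
  unfold c4 c1
  positivity

lemma levelSet_subset_dom (hx₀ : x₀ ∈ dom (objective f g)) :
    levelSet f g x₀ ⊆ dom (objective f g) := fun _ hx =>
  (lt_of_le_of_lt hx (lt_top_iff_ne_top.2 hx₀)).ne

lemma sum_sq_le_sq_sum {n : ℕ} {l : Fin n → ℝ} (hl : ∀ i, 0 ≤ l i) :
    ∑ i, l i ^ 2 ≤ (∑ i, l i) ^ 2 := by
  rw [sq (∑ i, l i), Finset.sum_mul]
  refine Finset.sum_le_sum fun i _ => ?_
  rw [sq]
  exact mul_le_mul_of_nonneg_left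
    (Finset.single_le_sum (fun j _ => hl j) (Finset.mem_univ i)) (hl i)

namespace StandingAssumption

lemma sigmaF_le (H : StandingAssumption f g) (hx₀ : x₀ ∈ dom (objective f g)) {x : Space N}
    (hx : x ∈ levelSet f g x₀) : sigmaF f g x₀ ≤ minEigenvalue (hess f x) := by
  refine csInf_le ⟨0, ?_⟩ ⟨x, hx, rfl⟩
  rintro _ ⟨y, hy, rfl⟩
  exact minEigenvalue_nonneg (H.posDef y (levelSet_subset_dom hx₀ hy))

lemma sigmaF_nonneg (H : StandingAssumption f g) (hx₀ : x₀ ∈ dom (objective f g)) :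
    0 ≤ sigmaF f g x₀ := by
  refine Real.sInf_nonneg ?_
  rintro _ ⟨y, hy, rfl⟩
  exact minEigenvalue_nonneg (H.posDef y (levelSet_subset_dom hx₀ hy))

/-- The sum of the local norms of the inexact block directions dominates `c₄` times any lower
bound `t` on the local dual norms of the subgradients of `F`. -/
lemma c4_mul_le_sum (H : StandingAssumption f g) (hn : 0 < n) {η c₃ : ℝ} (hη0 : 0 ≤ η)
    (hη1 : η < 1) (hx₀ : x₀ ∈ dom (objective f g)) (hc₃ : ErrorBound f g x₀ c₃)
    {x d : Space N} (hx : x ∈ levelSet f g x₀)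
    (hd : ∀ i, IsApproxBlockDir f g η x i (block i d)) {t : ℝ}
    (ht : ∀ s ∈ subdiff (objective f g) x, t ≤ dualNorm (hess f x) s) :
    c4 f g x₀ η c₃ * t ≤ ∑ i, blockLambda f x i (block i d) := by
  have hxd := levelSet_subset_dom hx₀ hx
  have hA := H.posDef x hxd
  have hl : ∀ i, 0 ≤ blockLambda f x i (block i d) := fun i => wnorm_nonneg _ _
  have hsum : 0 ≤ ∑ i, blockLambda f x i (block i d) := Finset.sum_nonneg fun i _ => hl i
  set K := sSup (blockCond f η '' levelSet f g x₀) with hK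
  -- If `K = 0` (dimension zero, or `blockCond` unbounded on the level set), then `c₁` and `c₄`
  -- vanish by the convention for division by zero and the bound is trivial.
  rcases (sSup_blockCond_nonneg (f := f) hη0 (levelSet f g x₀)).eq_or_lt with hK0 | hKpos
  · have : c4 f g x₀ η c₃ = 0 := by simp [c4, c1, ← hK0]
    rw [this, zero_mul]; exact hsum
  have hbdd : BddAbove (blockCond f η '' levelSet f g x₀) := by
    by_contra h
    exact hKpos.ne' (Real.sSup_of_not_bddAbove h)
  have hKx : blockCond f η x ≤ K := le_csSup hbdd ⟨x, hx, rfl⟩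
  have hS : ∃ w S : Space N, ∀ i, block i S ∈ subdiff (g i) (block i w) := by
    choose v s hs hvs hv using hd
    exact ⟨x + d, WithLp.toLp 2 fun a => s a.1 a.2, hs⟩
  obtain ⟨w, S, hS⟩ := hS
  obtain ⟨d', hd'⟩ := H.exists_isProxNewtonDir hxd hS
  have hcmp := H.wnorm_proxNewton_le hη0 hη1.le hxd hd hd'
  have hErr : c₃ * t ≤ ‖d'‖ := by
    have h1 := hc₃.2 x hx d' hd'
    have h2 : ENNReal.ofReal t ≤ minSubgradNorm f g x :=
      le_iInf₂ fun s hs => ENNReal.ofReal_le_ofReal (ht s hs)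
    have h3 := (mul_le_mul_right h2 (ENNReal.ofReal c₃)).trans h1
    rw [← ENNReal.ofReal_mul hc₃.1.le] at h3
    exact (ENNReal.ofReal_le_ofReal_iff (norm_nonneg _)).1 h3
  set σ := sigmaF f g x₀
  have hσ0 : 0 ≤ σ := H.sigmaF_nonneg hx₀
  have hnorm : √σ * ‖d'‖ ≤ wnorm (hess f x) d' := by
    refine abs_le_of_sq_le_sq' ?_ (wnorm_nonneg _ _) |>.2
    rw [mul_pow, Real.sq_sqrt hσ0]
    exact (mul_le_mul_of_nonneg_right (H.sigmaF_le hx₀ hx) (sq_nonneg _)).trans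
      (minEigenvalue_mul_norm_sq_le hA d')
  have hHd : wnorm (blockHess f x) d ≤ ∑ i, blockLambda f x i (block i d) := by
    refine abs_le_of_sq_le_sq' ?_ hsum |>.2
    rw [wnorm_blockHess_sq hA]
    exact sum_sq_le_sq_sum hl
  have hc4 : c4 f g x₀ η c₃ = c₃ * √σ / K := by
    have hsn : √(n : ℝ) ≠ 0 := (Real.sqrt_pos.2 (by exact_mod_cast hn)).ne'
    have h1 : 1 - η ≠ 0 := by linarith
    rw [c4, c1, Real.sqrt_mul (Nat.cast_nonneg n)]
    change (1 - η) / (√n * K) * c₃ * (√n * √σ) / (1 - η) = _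
    field_simp
  rw [hc4, div_mul_eq_mul_div, div_le_iff₀ hKpos]
  calc c₃ * √σ * t = √σ * (c₃ * t) := by ring
    _ ≤ √σ * ‖d'‖ := mul_le_mul_of_nonneg_left hErr (Real.sqrt_nonneg _)
    _ ≤ wnorm (hess f x) d' := hnorm
    _ ≤ blockCond f η x * wnorm (blockHess f x) d := hcmp
    _ ≤ K * ∑ i, blockLambda f x i (block i d) :=
        mul_le_mul hKx hHd (wnorm_nonneg _ _) hKpos.le
    _ = (∑ i, blockLambda f x i (block i d)) * K := mul_comm _ _

/-- The optimal value is attained and finite. -/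
lemma exists_minimizer (H : StandingAssumption f g) (hx₀ : x₀ ∈ dom (objective f g)) :
    ∃ y ∈ dom (objective f g), (optVal f g).toReal = (objective f g y).toReal := by
  obtain ⟨y, hy, -⟩ := H.unique_min
  have h : optVal f g = objective f g y :=
    le_antisymm (iInf_le _ y) (le_iInf fun z => hy (Set.mem_univ z))
  refine ⟨y, ?_, by rw [h]⟩
  exact (lt_of_le_of_lt (hy (Set.mem_univ x₀)) (lt_top_iff_ne_top.2 hx₀)).ne

lemma optVal_le (H : StandingAssumption f g) {x : Space N}
    (hx : x ∈ dom (objective f g)) : (optVal f g).toReal ≤ (objective f g x).toReal := by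
  obtain ⟨y, hy, -⟩ := H.unique_min
  have h : optVal f g = objective f g y :=
    le_antisymm (iInf_le _ y) (le_iInf fun z => hy (Set.mem_univ z))
  rw [h]
  exact EReal.toReal_le_toReal (hy (Set.mem_univ x)) (H.objective_ne_bot y) hx

/-- The average decrease over the blocks is at least a fixed fraction of the optimality gap. -/
lemma gap_mul_le_sum_omega (H : StandingAssumption f g) {η c₃ : ℝ} (hη0 : 0 ≤ η)
    (hη1 : η < 1) (hx₀ : x₀ ∈ dom (objective f g)) (hc₃ : ErrorBound f g x₀ c₃)
    {p : Fin n → ℝ} (hp : ∀ i, 0 < p i) (hp_sum : ∑ i, p i = 1)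
    {x d : Space N} (hx : x ∈ levelSet f g x₀)
    (hd : ∀ i, IsApproxBlockDir f g η x i (block i d)) {Fstar t₀ : ℝ}
    (hFstar : Fstar = (optVal f g).toReal)
    (ht₀ : t₀ = omegaStarInv ((objective f g x₀).toReal - Fstar)) :
    c4 f g x₀ η c₃ ^ 2 * pMin p ^ 2 * (1 - t₀) / (2 * (1 + c4 f g x₀ η c₃ * pMin p * t₀)) *
        ((objective f g x).toReal - Fstar) ≤
      1 / 2 * ∑ i, p i * omega (blockLambda f x i (block i d)) := by
  have hn : 0 < n := by
    rcases Nat.eq_zero_or_pos n with rfl | h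
    · simp at hp_sum
    · exact h
  have : Nonempty (Fin n) := ⟨⟨0, hn⟩⟩
  have hxd := levelSet_subset_dom hx₀ hx
  set δ := (objective f g x).toReal - Fstar with hδ
  set δ₀ := (objective f g x₀).toReal - Fstar with hδ₀
  have hδ0 : 0 ≤ δ := by rw [hδ, hFstar]; linarith [H.optVal_le hxd]
  have hδδ₀ : δ ≤ δ₀ := sub_le_sub_right (EReal.toReal_le_toReal hx (H.objective_ne_bot x) hx₀) _
  have hδ₀0 : 0 ≤ δ₀ := hδ0.trans hδδ₀
  set t := omegaStarInv δ with ht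
  obtain ⟨ht0, ht1⟩ := omegaStarInv_mem hδ0
  obtain ⟨ht₀0, ht₀1⟩ := omegaStarInv_mem hδ₀0
  rw [← ht] at ht0 ht1
  rw [← ht₀] at ht₀0 ht₀1
  have htt₀ : t ≤ t₀ := omegaStarInv_le hδ0 ht₀0 fun _ => by
    rw [ht₀, omegaStar_omegaStarInv hδ₀0]; exact hδδ₀
  have hts : ∀ s ∈ subdiff (objective f g) x, t ≤ dualNorm (hess f x) s := by
    intro s hs
    refine omegaStarInv_le hδ0 (dualNorm_nonneg _ _) fun h1 => ?_
    obtain ⟨y, hy, hyv⟩ := H.exists_minimizer hx₀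
    rw [hδ, hFstar, hyv]
    exact H.objective_sub_le_omegaStar hs hy h1
  have hsum := H.c4_mul_le_sum hn hη0 hη1 hx₀ hc₃ hx hd hts
  have hc0 : 0 ≤ c4 f g x₀ η c₃ := c4_nonneg hη0 hη1.le hc₃.1.le
  set c := c4 f g x₀ η c₃
  have hl : ∀ i, 0 ≤ blockLambda f x i (block i d) := fun i => wnorm_nonneg _ _
  have hpm : ∀ i, pMin p ≤ p i := fun i => ciInf_le (Set.finite_range p).bddBelow i
  have hpm0 : 0 ≤ pMin p := le_ciInf fun i => (hp i).le
  set a := c * pMin p with ha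
  have ha0 : 0 ≤ a := mul_nonneg hc0 hpm0
  have hat : a * t ≤ ∑ i, p i * blockLambda f x i (block i d) := by
    calc a * t = pMin p * (c * t) := by rw [ha]; ring
      _ ≤ pMin p * ∑ i, blockLambda f x i (block i d) := mul_le_mul_of_nonneg_left hsum hpm0
      _ ≤ _ := by
        rw [Finset.mul_sum]
        exact Finset.sum_le_sum fun i _ => mul_le_mul_of_nonneg_right (hpm i) (hl i)
  have hat0 : 0 ≤ a * t := mul_nonneg ha0 ht0
  have hω : (a * t) ^ 2 / (2 * (1 + a * t)) ≤
      ∑ i, p i * omega (blockLambda f x i (block i d)) :=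
    ((sq_div_le_omega hat0).trans (omega_mono hat0 hat)).trans
      (omega_sum_le (fun i => (hp i).le) hp_sum hl)
  -- `δ = ω_*(t) ≤ t² / (2 (1 - t))`
  have hδt : δ * (2 * (1 - t)) ≤ t ^ 2 := by
    have h := omegaStar_le_sq_div ht0 ht1
    rw [ht, omegaStar_omegaStarInv hδ0, ← ht, le_div_iff₀ (by linarith)] at h
    exact h
  have h1 : a ^ 2 * (1 - t₀) / (2 * (1 + a * t₀)) * δ ≤
      a ^ 2 * (1 - t) / (2 * (1 + a * t)) * δ := by
    refine mul_le_mul_of_nonneg_right ?_ hδ0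
    have h2 : a * t ≤ a * t₀ := mul_le_mul_of_nonneg_left htt₀ ha0
    refine div_le_div₀ (mul_nonneg (sq_nonneg _) (by linarith)) ?_ (by linarith) (by linarith)
    exact mul_le_mul_of_nonneg_left (by linarith) (sq_nonneg _)
  have h2 : a ^ 2 * (1 - t) / (2 * (1 + a * t)) * δ ≤
      1 / 2 * ((a * t) ^ 2 / (2 * (1 + a * t))) := by
    rw [div_mul_eq_mul_div, ← mul_div_assoc]
    refine div_le_div_of_nonneg_right ?_ (by linarith)
    have := mul_le_mul_of_nonneg_left hδt (sq_nonneg a)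
    rw [mul_pow]
    linarith
  have e : c ^ 2 * pMin p ^ 2 = a ^ 2 := by rw [ha, mul_pow]
  rw [e]
  linarith

end StandingAssumption

end ExpectedDecrease

/-! ### The random iterates -/

section Iterates

variable {n : ℕ} {N : Fin n → ℕ} {f : Space N → EReal} {g : ∀ i, Block N i → EReal}

lemma measurable_hess_apply (f : Space N → EReal) (a b : Σ i : Fin n, Fin (N i)) :
    Measurable fun x => hess f x a b := by
  have h := measurable_fderiv_apply_const ℝ (fderiv ℝ fun y => (f y).toReal)
    (EuclideanSpace.single a (1 : ℝ))
  exact (ContinuousLinearMap.apply ℝ ℝ (EuclideanSpace.single b (1 : ℝ))).continuous.measurable.comp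
    h

lemma measurable_blockLambda (f : Space N → EReal) (i : Fin n) :
    Measurable fun z : Space N × Space N => blockLambda f z.1 i (block i z.2) := by
  unfold blockLambda wnorm
  simp only [Matrix.inner_toEuclideanCLM, dotProduct, Matrix.mulVec, diagBlock,
    Matrix.submatrix_apply, block_apply]
  refine Measurable.sqrt ?_
  have hc : ∀ a : Σ i : Fin n, Fin (N i), Measurable fun z : Space N × Space N => z.2 a :=
    fun a => by fun_prop
  refine Finset.measurable_sum _ fun l _ => (hc _).mul ?_
  exact Finset.measurable_sum _ fun l' _ =>
    ((measurable_hess_apply f _ _).comp measurable_fst).mul (hc _)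

lemma measurable_omega : Measurable omega := by
  unfold omega
  fun_prop

variable {Ω : Type*} [MeasurableSpace Ω] {μ : Measure Ω} {η : ℝ} {p : Fin n → ℝ} {x₀ : Space N}
  {ι : ℕ → Ω → Fin n} {D X : ℕ → Ω → Space N}

/-- Every step decreases the objective, so the iterates stay in the level set of `x⁰`. -/
lemma IsRBPDN.mem_levelSet (hX : IsRBPDN μ f g η p x₀ ι D X) (H : StandingAssumption f g)
    (hη : η ≤ 1 / 4) (hx₀ : x₀ ∈ dom (objective f g)) (k : ℕ) :
    ∀ᵐ ω ∂μ, X k ω ∈ levelSet f g x₀ := by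
  induction k with
  | zero =>
    filter_upwards [hX.init] with ω hω
    change objective f g (X 0 ω) ≤ _
    rw [hω]
  | succ k ih =>
    filter_upwards [ih, hX.approx k, hX.step k] with ω h1 h2 h3
    have hd := levelSet_subset_dom hx₀ h1
    obtain ⟨h4, h5⟩ := H.dampedStep_descent hη hd (h2 (ι k ω))
    rw [h3]
    refine le_trans (b := objective f g (X k ω)) ?_ h1
    rw [← EReal.coe_toReal h4 (H.objective_ne_bot _), ← EReal.coe_toReal hd (H.objective_ne_bot _)]
    have := omega_nonneg (wnorm_nonneg (diagBlock (hess f (X k ω)) (ι k ω))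
      (block (ι k ω) (D k ω)))
    refine EReal.coe_le_coe_iff.2 (h5.trans ?_)
    unfold blockLambda
    linarith

lemma IsRBPDN.integrable [IsProbabilityMeasure μ] (hX : IsRBPDN μ f g η p x₀ ι D X)
    (H : StandingAssumption f g) (hη : η ≤ 1 / 4) (hx₀ : x₀ ∈ dom (objective f g)) (k : ℕ) :
    Integrable (fun ω => (objective f g (X k ω)).toReal) μ := by
  refine Integrable.of_mem_Icc (optVal f g).toReal (objective f g x₀).toReal
    ((H.lowerSemicontinuous_objective.measurable.comp
      (hX.measurable_iterate k)).ereal_toReal.aemeasurable) ?_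
  filter_upwards [hX.mem_levelSet H hη hx₀ k] with ω hω
  exact ⟨H.optVal_le (levelSet_subset_dom hx₀ hω),
    EReal.toReal_le_toReal hω (H.objective_ne_bot _) hx₀⟩

/-- The drawn index is independent of the decrease available in each block. -/
lemma IsRBPDN.integral_indicator_mul_omega [IsProbabilityMeasure μ]
    (hX : IsRBPDN μ f g η p x₀ ι D X) (hp : ∀ i, 0 ≤ p i) (k : ℕ) (i : Fin n) :
    ∫ ω, (ι k ⁻¹' {i}).indicator 1 ω * omega (blockLambda f (X k ω) i (block i (D k ω))) ∂μ =
      p i * ∫ ω, omega (blockLambda f (X k ω) i (block i (D k ω))) ∂μ := by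
  have hm : Measurable fun z : Space N × Space N => omega (blockLambda f z.1 i (block i z.2)) :=
    measurable_omega.comp (measurable_blockLambda f i)
  have hset : MeasurableSet (ι k ⁻¹' {i}) := hX.measurable_index k (measurableSet_singleton i)
  have hind := (hX.indep k).comp
    (φ := fun j : Fin n => ({i} : Set (Fin n)).indicator (1 : Fin n → ℝ) j)
    (measurable_of_countable _) hm
  have h := hind.integral_fun_mul_eq_mul_integral
    ((measurable_of_countable _).comp (hX.measurable_index k)).aestronglyMeasurable
    (hm.comp ((hX.measurable_iterate k).prodMk (hX.measurable_dir k))).aestronglyMeasurable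
  have hpi : μ.real (ι k ⁻¹' {i}) = p i := by
    have : ι k ⁻¹' {i} = {ω | ι k ω = i} := rfl
    rw [this, measureReal_def, hX.law k i, ENNReal.toReal_ofReal (hp i)]
  rw [← hpi, ← integral_indicator_one hset]
  exact h

/-- One iteration contracts the expected optimality gap by the factor `q`. -/
lemma IsRBPDN.integral_gap_succ_le [IsProbabilityMeasure μ] (hX : IsRBPDN μ f g η p x₀ ι D X)
    (H : StandingAssumption f g) (hη : η ∈ Set.Icc (0 : ℝ) (1 / 4))
    (hx₀ : x₀ ∈ dom (objective f g)) (hp : ∀ i, 0 < p i) (hp_sum : ∑ i, p i = 1)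
    {c₃ : ℝ} (hc₃ : ErrorBound f g x₀ c₃) {Fstar t₀ r : ℝ}
    (hFstar : Fstar = (optVal f g).toReal)
    (ht₀ : t₀ = omegaStarInv ((objective f g x₀).toReal - Fstar))
    (hr : r = c4 f g x₀ η c₃ ^ 2 * pMin p ^ 2 * (1 - t₀) /
      (2 * (1 + c4 f g x₀ η c₃ * pMin p * t₀))) (k : ℕ) :
    ∫ ω, ((objective f g (X (k + 1) ω)).toReal - Fstar) ∂μ ≤
      (1 - r) * ∫ ω, ((objective f g (X k ω)).toReal - Fstar) ∂μ := by
  set L : Fin n → Ω → ℝ := fun i ω => omega (blockLambda f (X k ω) i (block i (D k ω))) with hL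
  have hlev := hX.mem_levelSet H hη.2 hx₀ k
  have hV : ∀ j, Integrable (fun ω => (objective f g (X j ω)).toReal - Fstar) μ := fun j =>
    (hX.integrable H hη.2 hx₀ j).sub (integrable_const Fstar)
  have hLmeas : ∀ i, Measurable (L i) := by
    intro i
    have hm : Measurable fun z : Space N × Space N => omega (blockLambda f z.1 i (block i z.2)) :=
      measurable_omega.comp (measurable_blockLambda f i)
    have hc := hm.comp ((hX.measurable_iterate k).prodMk (hX.measurable_dir k))
    exact hc
  have hLint : ∀ i, Integrable (L i) μ := by
    intro i
    refine Integrable.of_mem_Icc 0 (2 * ((objective f g x₀).toReal - Fstar))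
      (hLmeas i).aemeasurable ?_
    filter_upwards [hlev, hX.approx k] with ω h1 h2
    have hd := levelSet_subset_dom hx₀ h1
    obtain ⟨h4, h5⟩ := H.dampedStep_descent hη.2 hd (h2 i)
    have h6 := H.optVal_le h4
    have h7 := EReal.toReal_le_toReal h1 (H.objective_ne_bot _) hx₀
    refine ⟨omega_nonneg (wnorm_nonneg _ _), ?_⟩
    rw [hFstar]
    simp only [hL]
    linarith
  have hset : ∀ i, MeasurableSet (ι k ⁻¹' {i}) := fun i =>
    hX.measurable_index k (measurableSet_singleton i)
  have hprod : ∀ i, Integrable (fun ω => (ι k ⁻¹' {i}).indicator 1 ω * L i ω) μ := by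
    intro i
    refine ((hLint i).indicator (hset i)).congr (Filter.Eventually.of_forall fun ω => ?_)
    by_cases h : ω ∈ ι k ⁻¹' {i} <;> simp [h]
  have hstep : ∀ᵐ ω ∂μ, (objective f g (X (k + 1) ω)).toReal - Fstar ≤
      ((objective f g (X k ω)).toReal - Fstar) -
        1 / 2 * ∑ i, (ι k ⁻¹' {i}).indicator 1 ω * L i ω := by
    filter_upwards [hlev, hX.approx k, hX.step k] with ω h1 h2 h3
    have hd := levelSet_subset_dom hx₀ h1
    have h5 := (H.dampedStep_descent hη.2 hd (h2 (ι k ω))).2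
    have hs : ∑ i, (ι k ⁻¹' {i}).indicator 1 ω * L i ω = L (ι k ω) ω := by
      rw [Finset.sum_eq_single (ι k ω)]
      · simp
      · intro j _ hj
        have : ω ∉ ι k ⁻¹' {j} := fun h => hj h.symm
        rw [Set.indicator_of_notMem this, zero_mul]
      · simp
    rw [hs, h3]
    simp only [hL]
    linarith
  have hgap : ∀ᵐ ω ∂μ, r * ((objective f g (X k ω)).toReal - Fstar) ≤
      1 / 2 * ∑ i, p i * L i ω := by
    filter_upwards [hlev, hX.approx k] with ω h1 h2
    rw [hr]
    exact H.gap_mul_le_sum_omega hη.1 (by linarith [hη.2]) hx₀ hc₃ hp hp_sum h1 h2 hFstar ht₀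
  have hsumint : Integrable (fun ω => 1 / 2 * ∑ i, (ι k ⁻¹' {i}).indicator 1 ω * L i ω) μ :=
    (integrable_finsetSum _ fun i _ => hprod i).const_mul _
  have hsumint' : Integrable (fun ω => 1 / 2 * ∑ i, p i * L i ω) μ :=
    (integrable_finsetSum _ fun i _ => (hLint i).const_mul (p i)).const_mul _
  have hEq : ∫ ω, 1 / 2 * ∑ i, (ι k ⁻¹' {i}).indicator 1 ω * L i ω ∂μ =
      ∫ ω, 1 / 2 * ∑ i, p i * L i ω ∂μ := by
    rw [integral_const_mul, integral_const_mul, integral_finsetSum _ fun i _ => hprod i,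
      integral_finsetSum _ fun i _ => (hLint i).const_mul (p i)]
    congr 1
    refine Finset.sum_congr rfl fun i _ => ?_
    rw [integral_const_mul]
    exact hX.integral_indicator_mul_omega (fun i => (hp i).le) k i
  have h1 := integral_mono_ae (hV (k + 1)) ((hV k).sub' hsumint) hstep
  have h2 := integral_mono_ae ((hV k).const_mul r) hsumint' hgap
  rw [integral_sub (hV k) hsumint, hEq] at h1
  rw [integral_const_mul] at h2
  linarith

end Iterates

end RBPDN

theorem theorem4p2 {n : ℕ} (N : Fin n → ℕ)
    (f : Space N → EReal) (g : ∀ i, Block N i → EReal)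
    (hfg : StandingAssumption f g)
    (x₀ : Space N) (hx₀ : x₀ ∈ dom (objective f g))
    (η : ℝ) (hη : η ∈ Set.Icc (0 : ℝ) (1 / 4))
    (p : Fin n → ℝ) (hp : ∀ i, 0 < p i) (hp_sum : ∑ i, p i = 1)
    {Ω : Type*} [MeasurableSpace Ω] (μ : Measure Ω) [IsProbabilityMeasure μ]
    (ι : ℕ → Ω → Fin n) (D X : ℕ → Ω → Space N)
    (hX : IsRBPDN μ f g η p x₀ ι D X)
    (c₃ : ℝ) (hc₃ : ErrorBound f g x₀ c₃)
    (Fstar δ₀ c₄ q : ℝ)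
    (hFstar : Fstar = (optVal f g).toReal)
    (hδ₀ : δ₀ = (objective f g x₀).toReal - Fstar)
    (hc₄ : c₄ = c4 f g x₀ η c₃)
    (hq : q = 1 - c₄ ^ 2 * pMin p ^ 2 * (1 - omegaStarInv δ₀)
      / (2 * (1 + c₄ * pMin p * omegaStarInv δ₀)))
    (k : ℕ) :
    (∀ᵐ ω ∂μ, objective f g (X k ω) ≠ ⊤) ∧
      Integrable (fun ω => (objective f g (X k ω)).toReal) μ ∧
      ∫ ω, ((objective f g (X k ω)).toReal - Fstar) ∂μ
        ≤ q ^ k * ((objective f g x₀).toReal - Fstar) := by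
  have hlev := hX.mem_levelSet hfg hη.2 hx₀
  have hint := hX.integrable hfg hη.2 hx₀
  refine ⟨(hlev k).mono fun ω hω => levelSet_subset_dom hx₀ hω, hint k, ?_⟩
  have hstep : ∀ j, ∫ ω, ((objective f g (X (j + 1) ω)).toReal - Fstar) ∂μ ≤
      q * ∫ ω, ((objective f g (X j ω)).toReal - Fstar) ∂μ := by
    subst hδ₀ hc₄ hq
    exact hX.integral_gap_succ_le hfg hη hx₀ hp hp_sum hc₃ hFstar rfl rfl
  have hnonneg : ∀ j, 0 ≤ ∫ ω, ((objective f g (X j ω)).toReal - Fstar) ∂μ := by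
    intro j
    refine integral_nonneg_of_ae ?_
    filter_upwards [hlev j] with ω hω
    change 0 ≤ _ - _
    rw [hFstar]
    linarith [hfg.optVal_le (levelSet_subset_dom hx₀ hω)]
  have hle : ∀ j, ∫ ω, ((objective f g (X j ω)).toReal - Fstar) ∂μ ≤ δ₀ := by
    intro j
    have h := integral_mono_ae ((hint j).sub (integrable_const Fstar))
      (integrable_const (μ := μ) δ₀) (by
        filter_upwards [hlev j] with ω hω
        have := EReal.toReal_le_toReal hω (hfg.objective_ne_bot _) hx₀
        simp only [Pi.sub_apply]
        linarith)
    simpa using h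
  have h0 : ∫ ω, ((objective f g (X 0 ω)).toReal - Fstar) ∂μ = δ₀ := by
    have : ∫ ω, ((objective f g (X 0 ω)).toReal - Fstar) ∂μ = ∫ _, δ₀ ∂μ := by
      refine integral_congr_ae ?_
      filter_upwards [hX.init] with ω hω
      rw [hω, hδ₀]
    rw [this]; simp
  rw [← hδ₀]
  rcases (h0 ▸ hnonneg 0 : 0 ≤ δ₀).eq_or_lt with hz | hpos
  · rw [← hz, mul_zero]
    exact hz ▸ hle k
  -- The expected gap after one step is nonnegative, which forces `q ≥ 0`.
  have hq0 : 0 ≤ q := by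
    have h := (hnonneg 1).trans (hstep 0)
    rw [h0] at h
    exact nonneg_of_mul_nonneg_left h hpos
  clear hq
  induction k with
  | zero => rw [h0, pow_zero, one_mul]
  | succ k ih =>
    calc _ ≤ q * ∫ ω, ((objective f g (X k ω)).toReal - Fstar) ∂μ := hstep k
      _ ≤ q * (q ^ k * δ₀) := mul_le_mul_of_nonneg_left ih hq0
      _ = q ^ (k + 1) * δ₀ := by ring
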